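/- Fix integers $n$ (controllers) and $T$ (horizon). Consider the linear system \[ X_{t+1}=AX_t+BU_t+W_t,\quad t=1,\dots,T-1,\qquad Y_t=CX_t+V_t,\quad t=1,\dots,T, \] with $U_t=\mathrm{vec}(U_t^1,\dots,U_t^n)$ and $Y_t=\mathrm{vec}(Y_t^1,\dots,Y_t^n)$, where controller $i$ chooses $U^i_t$ and observes $Y^i_t$. The variables $X_1\sim\mathcal N(0,\Sigma_x)$, $W_t\sim\mathcal N(0,\Sigma_w)$ ($1\le t\le T-1$) and $V_t\sim\mathcal N(0,\Sigma_v)$ ($1\le t\le T$) are mutually independent, and the cost of control strategies is $\mathcal J=\mathrm E\big[\sum_{t=1}^T (MX_t+NU_t)^{\top}(MX_t+NU_t)\big]$. Write $B=[B^1\ \cdots\ B^n]$ and $N=[N^1\ \cdots\ N^n]$ for the column blocks matching $U^1_t,\dots,U^n_t$. Assume substitutability: for every $u=\mathrm{vec}(u^1,\dots,u^n)$ and every $i$ there is $v^i$ with $Bu=B^iv^i$ and $Nu=N^iv^i$. Put \[ \Lambda^i=\begin{bmatrix}B^i\\N^i\end{bmatrix}^{\dagger}\begin{bmatrix}B\\N\end{bmatrix},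 \] where $\dagger$ is the Moore–Penrose pseudo-inverse. Define the Kalman gains $L_t$ by $P_1=\Sigma_x$ and \[ L_t=P_tC^{\top}(CP_tC^{\top}+\Sigma_v)^{-1},\quad \Sigma_t=(I-L_tC)P_t,\quad P_{t+1}=A\Sigma_tA^{\top}+\Sigma_w, \] where the matrices $CP_tC^{\top}+\Sigma_v$, $1\le t\le T$, are assumed invertible. Write $L_t=[L^1_t\ \cdots\ L^n_t]$ for the column blocks matching $Y^1_t,\dots,Y^n_t$. In the centralized problem, $U_t$ is a (measurable) function of $Y_{1:t},U_{1:t-1}$. In the decentralized problem, each $U^i_t$ is a (measurable) function of $Y^i_{1:t},U^i_{1:t-1}$ only. In both problems $\mathcal J$ is minimized. Let \[ Z_1=L_1Y_1,\qquad Z_{t+1}=(I-L_{t+1}C)(AZ_t+BU_t)+L_{t+1}Y_{t+1}. \] Then there are matrices $K_1,\dots,K_T$ such that $U_t=K_tZ_t$ is an optimal strategy of the centralized problem. For all such matrices, the following hold. (1) Under the strategy $U_t=K_tZ_t$, one has $Z_t=\mathrm E[X_t\mid Y_{1:t},U_{1:t-1}]$ almost surely for $1\le t\le T$. (2) The strategies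 $U^i_t=\Lambda^iK_tS^i_t$, $i=1,\dots,n$, with \[ S^i_1=L^i_1Y^i_1,\qquad S^i_{t+1}=(I-L_{t+1}C)(AS^i_t+B^iU^i_t)+L^i_{t+1}Y^i_{t+1}, \] are optimal in the decentralized problem. (3) The strategies in (2) attain the same cost as the centralized optimum, and this cost is finite. -/

import Mathlib

open MeasureTheory ProbabilityTheory Matrix
open scoped ENNReal

noncomputable section

/-- The Moore-Penrose pseudo-inverse of a real matrix, `A† = (AᵀA)† Aᵀ`, where the pseudo-inverse
of the symmetric matrix `AᵀA` inverts its nonzero eigenvalues and keeps its zero eigenvalues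
(in Lean `0⁻¹ = 0`). See `pinv_penrose` for the four Penrose equations. -/
def pinv {m k : Type*} [Fintype m] [Fintype k] [DecidableEq k] (P : Matrix m k ℝ) :
    Matrix k m ℝ :=
  cfc (fun x : ℝ => x⁻¹) (Pᵀ * P) * Pᵀ

/-- `pinv P` satisfies the four Penrose equations, which characterize the pseudo-inverse. -/
theorem pinv_penrose {m k : Type*} [Fintype m] [Fintype k] [DecidableEq k] (P : Matrix m k ℝ) :
    P * pinv P * P = P ∧ pinv P * P * pinv P = pinv P ∧
      (P * pinv P)ᵀ = P * pinv P ∧ (pinv P * P)ᵀ = pinv P * P := by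
  set H : Matrix k k ℝ := Pᵀ * P with hH
  set G : Matrix k k ℝ := cfc (fun x : ℝ => x⁻¹) H with hG
  have hsa : IsSelfAdjoint H := by
    rw [IsSelfAdjoint, star_eq_conjTranspose, conjTranspose_eq_transpose_of_trivial, hH,
      transpose_mul, transpose_transpose]
  have hc : ∀ f : ℝ → ℝ, ContinuousOn f (spectrum ℝ H) := fun f =>
    (Matrix.finite_real_spectrum).continuousOn f
  have hid : cfc (fun x : ℝ => x) H = H := cfc_id' ℝ H hsa
  have hGT : Gᵀ = G := by
    have : IsSelfAdjoint G := cfc_predicate _ _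
    rwa [IsSelfAdjoint, star_eq_conjTranspose, conjTranspose_eq_transpose_of_trivial] at this
  have hHT : Hᵀ = H := by
    rwa [IsSelfAdjoint, star_eq_conjTranspose, conjTranspose_eq_transpose_of_trivial] at hsa
  have hGH : G * H = cfc (fun x : ℝ => x⁻¹ * x) H := by
    rw [cfc_mul _ _ H (hc _) (hc _), hid]
  have hHG : H * G = cfc (fun x : ℝ => x * x⁻¹) H := by
    rw [cfc_mul _ _ H (hc _) (hc _), hid]
  have hcomm : H * G = G * H := by rw [hGH, hHG]; simp only [mul_comm]
  have hGHG : G * H * G = G := by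
    rw [hGH, hG, ← cfc_mul _ _ H (hc _) (hc _)]
    congr 1; funext x; by_cases hx : x = 0 <;> simp [hx]
  have hHGH : H * (G * H) = H := by
    rw [hGH]
    have h1 : H * cfc (fun x : ℝ => x⁻¹ * x) H = cfc (fun x : ℝ => x * (x⁻¹ * x)) H := by
      rw [cfc_mul (fun x : ℝ => x) _ H (hc _) (hc _), hid]
    rw [h1]
    refine Eq.trans ?_ hid
    congr 1; funext x; by_cases hx : x = 0 <;> simp [hx]
  have hpinv : pinv P = G * Pᵀ := rfl
  refine ⟨?_, ?_, ?_, ?_⟩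
  · have h0 : P * (G * H - 1) = 0 := by
      have h1 : Pᵀ * (P * (G * H - 1)) = 0 := by
        rw [← Matrix.mul_assoc, ← hH, Matrix.mul_sub, hHGH, Matrix.mul_one, sub_self]
      have h2 := Matrix.conjTranspose_mul_self_mul_eq_zero P (G * H - 1)
      rw [conjTranspose_eq_transpose_of_trivial, Matrix.mul_assoc] at h2
      exact h2.1 h1
    rw [Matrix.mul_sub, Matrix.mul_one, sub_eq_zero] at h0
    rw [hpinv, Matrix.mul_assoc, Matrix.mul_assoc, ← hH, h0]
  · rw [hpinv, Matrix.mul_assoc G Pᵀ P, ← hH, ← Matrix.mul_assoc, hGHG]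
  · rw [hpinv, transpose_mul, transpose_mul, transpose_transpose, hGT, Matrix.mul_assoc]
  · rw [hpinv, Matrix.mul_assoc, ← hH, transpose_mul, hGT, hHT, hcomm]

/-- Data of a linear-quadratic-Gaussian system with `n` controllers. Controller `i` acts with
`U^i ∈ ℝ^(du i)` and observes `Y^i ∈ ℝ^(dy i)`; stacked vectors `vec(U^1,…,U^n)` and
`vec(Y^1,…,Y^n)` are indexed by pairs (controller, coordinate).
Dynamics `X_{t+1} = A X_t + B U_t + W_t`, observations `Y_t = C X_t + V_t`, stage cost
`(M X_t + N U_t)ᵀ (M X_t + N U_t)`; `covX`, `covW`, `covV` are the covariances of the initial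
state, the process noise and the (stacked) observation noise. -/
structure LQGSystem (n dx dc : ℕ) (du dy : Fin n → ℕ) where
  A : Matrix (Fin dx) (Fin dx) ℝ
  B : Matrix (Fin dx) (Σ i, Fin (du i)) ℝ
  C : Matrix (Σ i, Fin (dy i)) (Fin dx) ℝ
  M : Matrix (Fin dc) (Fin dx) ℝ
  N : Matrix (Fin dc) (Σ i, Fin (du i)) ℝ
  covX : Matrix (Fin dx) (Fin dx) ℝ
  covW : Matrix (Fin dx) (Fin dx) ℝ
  covV : Matrix (Σ i, Fin (dy i)) (Σ i, Fin (dy i)) ℝ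

namespace LQGSystem

/-- State vectors. -/
abbrev St (dx : ℕ) : Type := Fin dx → ℝ

/-- Stacked vectors `vec(z^1,…,z^n)` with `z^i ∈ ℝ^(d i)`. -/
abbrev Vec {n : ℕ} (d : Fin n → ℕ) : Type := (Σ i, Fin (d i)) → ℝ

/-- The `i`-th sub-vector of a stacked vector. -/
def block {n : ℕ} {d : Fin n → ℕ} (i : Fin n) (z : Vec d) : Fin (d i) → ℝ := fun a => z ⟨i, a⟩

/-- The stacked vector `vec(0,…,v,…,0)` with `v` in position `i`. -/
def embed {n : ℕ} {d : Fin n → ℕ} (i : Fin n) (v : Fin (d i) → ℝ) : Vec d :=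
  fun q => (Pi.single i v : (j : Fin n) → Fin (d j) → ℝ) q.1 q.2

/-- The `i`-th column block of a matrix `[P^1 … P^n]`. -/
def colBlock {r : Type*} {n : ℕ} {d : Fin n → ℕ} (P : Matrix r (Σ i, Fin (d i)) ℝ) (i : Fin n) :
    Matrix r (Fin (d i)) ℝ :=
  P.submatrix id (fun a => ⟨i, a⟩)

variable {n dx dc : ℕ} {du dy : Fin n → ℕ} (sys : LQGSystem n dx dc du dy)

/-- Every controller can substitute for all the others in open-loop control. -/
def Substitutable : Prop :=
  ∀ (u : Vec du) (i : Fin n), ∃ v : Fin (du i) → ℝ,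
    sys.B *ᵥ u = sys.B *ᵥ embed i v ∧ sys.N *ᵥ u = sys.N *ᵥ embed i v

/-- `Λ^i = [B^i; N^i]† [B; N]`. -/
def Lam (i : Fin n) : Matrix (Fin (du i)) (Σ i, Fin (du i)) ℝ :=
  pinv (fromRows (colBlock sys.B i) (colBlock sys.N i)) * fromRows sys.B sys.N

/-! ### Kalman filter. Time `t : ℕ` with `t < T` stands for the `(t+1)`-st of the `T` steps. -/

/-- The Kalman gain `P Cᵀ (C P Cᵀ + Σ_v)⁻¹` for a predicted error covariance `P`. -/
def gainOf (P : Matrix (Fin dx) (Fin dx) ℝ) : Matrix (Fin dx) (Σ i, Fin (dy i)) ℝ :=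
  P * sys.Cᵀ * (sys.C * P * sys.Cᵀ + sys.covV)⁻¹

/-- The predicted error covariance: `Σ_x` at the first step, then `A Σ_t Aᵀ + Σ_w`, where
`Σ_t = (I - L_t C) P_t` is the filtered error covariance. -/
def predCov : ℕ → Matrix (Fin dx) (Fin dx) ℝ
  | 0 => sys.covX
  | t + 1 => sys.A * ((1 - sys.gainOf (predCov t) * sys.C) * predCov t) * sys.Aᵀ + sys.covW

/-- The covariance `C P_t Cᵀ + Σ_v` that is inverted in the Kalman gain. -/
def innovCov (t : ℕ) : Matrix (Σ i, Fin (dy i)) (Σ i, Fin (dy i)) ℝ :=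
  sys.C * sys.predCov t * sys.Cᵀ + sys.covV

/-- The Kalman gain `L_t = [L^1_t … L^n_t]`. -/
def L (t : ℕ) : Matrix (Fin dx) (Σ i, Fin (dy i)) ℝ := sys.gainOf (sys.predCov t)

/-! ### Strategies and closed-loop trajectories -/

/-- Control strategy under the centralized information `Y_{1:t}, U_{1:t-1}`. -/
abbrev CentralStrategy {n : ℕ} (du dy : Fin n → ℕ) : Type :=
  (t : ℕ) → (Fin (t + 1) → Vec dy) → (Fin t → Vec du) → Vec du

/-- Control strategies `g^1,…,g^n`, where controller `i` uses its local information
`Y^i_{1:t}, U^i_{1:t-1}` only. -/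
abbrev LocalStrategy {n : ℕ} (du dy : Fin n → ℕ) : Type :=
  (i : Fin n) → (t : ℕ) → (Fin (t + 1) → Fin (dy i) → ℝ) → (Fin t → Fin (du i) → ℝ) →
    (Fin (du i) → ℝ)

/-- Measurability of a centralized strategy. -/
def CentralAdmissible (h : CentralStrategy du dy) : Prop :=
  ∀ t, Measurable (Function.uncurry (h t))

/-- Measurability of local strategies. -/
def LocalAdmissible (g : LocalStrategy du dy) : Prop :=
  ∀ i t, Measurable (Function.uncurry (g i t))

/-- The joint action `vec(U^1_t,…,U^n_t)` with `U^i_t = g^i_t(Y^i_{1:t}, U^i_{1:t-1})`. -/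
def joint (g : LocalStrategy du dy) : CentralStrategy du dy :=
  fun t ys us q => g q.1 t (fun s => block q.1 (ys s)) (fun s => block q.1 (us s)) q.2

/-- State at time `t`, with the observations and the actions strictly before time `t`, along the
sample path given by the initial state `x₁` and the noise sequences `w`, `v`. -/
def traj (h : CentralStrategy du dy) (x₁ : St dx) (w : ℕ → St dx) (v : ℕ → Vec dy) :
    (t : ℕ) → St dx × (Fin t → Vec dy) × (Fin t → Vec du)
  | 0 => (x₁, Fin.elim0, Fin.elim0)
  | t + 1 =>
    let x := (traj h x₁ w v t).1
    let ys : Fin (t + 1) → Vec dy :=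
      Fin.snoc (α := fun _ => Vec dy) (traj h x₁ w v t).2.1 (sys.C *ᵥ x + v t)
    let us := (traj h x₁ w v t).2.2
    let u := h t ys us
    (sys.A *ᵥ x + sys.B *ᵥ u + w t, ys, Fin.snoc (α := fun _ => Vec du) us u)

/-- The state `X_t`. -/
def state (h : CentralStrategy du dy) (x₁ : St dx) (w : ℕ → St dx) (v : ℕ → Vec dy) (t : ℕ) :
    St dx :=
  (sys.traj h x₁ w v t).1

/-- The centralized information `(Y_{1:t}, U_{1:t-1})` at time `t`. -/
def info (h : CentralStrategy du dy) (x₁ : St dx) (w : ℕ → St dx) (v : ℕ → Vec dy) (t : ℕ) :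
    (Fin (t + 1) → Vec dy) × (Fin t → Vec du) :=
  ((sys.traj h x₁ w v (t + 1)).2.1, (sys.traj h x₁ w v t).2.2)

/-- The joint action `U_t`. -/
def action (h : CentralStrategy du dy) (x₁ : St dx) (w : ℕ → St dx) (v : ℕ → Vec dy) (t : ℕ) :
    Vec du :=
  h t (sys.info h x₁ w v t).1 (sys.info h x₁ w v t).2

/-- The stage cost `(M x + N u)ᵀ (M x + N u)`. -/
def stageCost (x : St dx) (u : Vec du) : ℝ :=
  (sys.M *ᵥ x + sys.N *ᵥ u) ⬝ᵥ (sys.M *ᵥ x + sys.N *ᵥ u)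

/-! ### Probabilistic model and expected cost -/

/-- `X₁ ~ N(0, Σ_x)`, `W_t ~ N(0, Σ_w)`, `V_t ~ N(0, Σ_v)`, all mutually independent; only the
variables that occur in a problem of horizon `T` are constrained. -/
structure IsGaussianModel (T : ℕ) {Ω : Type*} [MeasurableSpace Ω] (μ : Measure Ω)
    (X₁ : Ω → St dx) (W : ℕ → Ω → St dx) (V : ℕ → Ω → Vec dy) : Prop where
  posX : sys.covX.PosSemidef
  posW : sys.covW.PosSemidef
  posV : sys.covV.PosSemidef
  measX : Measurable X₁
  measW : ∀ t, Measurable (W t)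
  measV : ∀ t, Measurable (V t)
  lawX : μ.map (fun ω => WithLp.toLp 2 (X₁ ω)) = multivariateGaussian 0 sys.covX
  lawW : ∀ t : Fin (T - 1),
    μ.map (fun ω => WithLp.toLp 2 (W t ω)) = multivariateGaussian 0 sys.covW
  lawV : ∀ t : Fin T,
    μ.map (fun ω => WithLp.toLp 2 (V t ω)) = multivariateGaussian 0 sys.covV
  indep : iIndep
    (Sum.elim (fun _ : Unit => MeasurableSpace.comap X₁ inferInstance)
      (Sum.elim (fun t : Fin (T - 1) => MeasurableSpace.comap (W t) inferInstance)
        (fun t : Fin T => MeasurableSpace.comap (V t) inferInstance))) μ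

/-- The expected total cost over `T` steps, in `[0, ∞]`. -/
def expCost (T : ℕ) {Ω : Type*} [MeasurableSpace Ω] (μ : Measure Ω)
    (X₁ : Ω → St dx) (W : ℕ → Ω → St dx) (V : ℕ → Ω → Vec dy) (h : CentralStrategy du dy) :
    ℝ≥0∞ :=
  ∫⁻ ω, ENNReal.ofReal (∑ t ∈ Finset.range T,
    sys.stageCost (sys.state h (X₁ ω) (fun s => W s ω) (fun s => V s ω) t)
      (sys.action h (X₁ ω) (fun s => W s ω) (fun s => V s ω) t)) ∂μ

/-- `h` is optimal in the problem with centralized information. -/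
def CentralOptimal (T : ℕ) {Ω : Type*} [MeasurableSpace Ω] (μ : Measure Ω)
    (X₁ : Ω → St dx) (W : ℕ → Ω → St dx) (V : ℕ → Ω → Vec dy) (h : CentralStrategy du dy) :
    Prop :=
  CentralAdmissible h ∧ ∀ h' : CentralStrategy du dy, CentralAdmissible h' →
    sys.expCost T μ X₁ W V h ≤ sys.expCost T μ X₁ W V h'

/-- `g` is optimal in the problem with decentralized information. -/
def LocalOptimal (T : ℕ) {Ω : Type*} [MeasurableSpace Ω] (μ : Measure Ω)
    (X₁ : Ω → St dx) (W : ℕ → Ω → St dx) (V : ℕ → Ω → Vec dy) (g : LocalStrategy du dy) :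
    Prop :=
  LocalAdmissible g ∧ ∀ g' : LocalStrategy du dy, LocalAdmissible g' →
    sys.expCost T μ X₁ W V (joint g) ≤ sys.expCost T μ X₁ W V (joint g')

/-! ### The filters and the strategies built from them -/

/-- The centralized filter `Z_t` as a function of `Y_{1:t}, U_{1:t-1}`:
`Z_1 = L_1 Y_1`, `Z_{t+1} = (I - L_{t+1} C)(A Z_t + B U_t) + L_{t+1} Y_{t+1}`. -/
def Z : (t : ℕ) → (Fin (t + 1) → Vec dy) → (Fin t → Vec du) → St dx
  | 0, ys, _ => sys.L 0 *ᵥ ys 0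
  | t + 1, ys, us =>
    (1 - sys.L (t + 1) * sys.C) *ᵥ
        (sys.A *ᵥ Z t (fun s => ys s.castSucc) (fun s => us s.castSucc)
          + sys.B *ᵥ us (Fin.last t))
      + sys.L (t + 1) *ᵥ ys (Fin.last (t + 1))

/-- The local filter `S^i_t` as a function of `Y^i_{1:t}, U^i_{1:t-1}`: `S^i_1 = L^i_1 Y^i_1`,
`S^i_{t+1} = (I - L_{t+1} C)(A S^i_t + B^i U^i_t) + L^i_{t+1} Y^i_{t+1}`. -/
def S (i : Fin n) : (t : ℕ) → (Fin (t + 1) → Fin (dy i) → ℝ) → (Fin t → Fin (du i) → ℝ) → St dx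
  | 0, ys, _ => colBlock (sys.L 0) i *ᵥ ys 0
  | t + 1, ys, us =>
    (1 - sys.L (t + 1) * sys.C) *ᵥ
        (sys.A *ᵥ S i t (fun s => ys s.castSucc) (fun s => us s.castSucc)
          + colBlock sys.B i *ᵥ us (Fin.last t))
      + colBlock (sys.L (t + 1)) i *ᵥ ys (Fin.last (t + 1))

/-- The centralized strategy `U_t = K_t Z_t`. -/
def centralKZ (K : ℕ → Matrix (Σ i, Fin (du i)) (Fin dx) ℝ) : CentralStrategy du dy :=
  fun t ys us => K t *ᵥ sys.Z t ys us

/-- The decentralized strategies `U^i_t = Λ^i K_t S^i_t`. -/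
def localKS (K : ℕ → Matrix (Σ i, Fin (du i)) (Fin dx) ℝ) : LocalStrategy du dy :=
  fun i t ys us => (sys.Lam i * K t) *ᵥ sys.S i t ys us

end LQGSystem

end

/-!
The proof separates estimation from control and then imitates the centralized optimum.

Along every trajectory the filtering error `X_t - Z_t` and the innovation
`Y_t - C (A Z_{t-1} + B U_{t-1})` are functions of the noise alone, whatever the strategy
(`state_eq_estimate_add_filtErr`, `observation_succ`). The Kalman gain makes the filtering error
uncorrelated with the current innovation; by Gaussianity it is independent of it, and inductively of
all innovations so far (`IsGaussianModel.kalman`). As the innovations determine the information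
`Y_{1:t}, U_{1:t-1}` (`measurable_info`), the error is independent of this information, which gives
the conditional mean, and the next innovation is independent of it as well.

Strategies are arbitrary measurable functions, so states and actions need not be square integrable
even when the cost is finite. All costs are therefore kept in `[0, ∞]`, and the only tool is
Pythagoras `E |e + f|² = E |e|² + E |f|²` for `e` square integrable, centred and independent of an
arbitrary `f` (`meanSq_add_of_indepFun`). It splits the cost into a constant and the cost of
controlling `Z_{t+1} = A Z_t + B U_t + L_{t+1} I_{t+1}`, where `I` is the innovation
(`IsGaussianModel.expCost_eq`), and it carries the backward dynamic programming for the latter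
(`exists_optimal_gains`). The value functions are kept in the form `|G x|² + c`, so that each
Bellman step is a least squares problem, solved by a pseudo-inverse (`exists_leastSquares_gain`); no
invertibility is needed.

For the decentralized problem, the local filters sum to `Z_t` (`sum_S_eq_Z`), and substitutability
gives `B^i Λ^i = B` and `N^i Λ^i = N`. Hence the joint action of the local strategies has the same
images under `B` and `N` as `K_t Z_t`, and the states and the costs coincide pathwise
(`Substitutable.expCost_joint_localKS`). Local strategies being centralized ones, this is optimal.
-/

noncomputable section

namespace LQGSystem

/-! ### Independence and second moments -/

theorem dotProduct_self_nonneg_real {ι : Type*} [Fintype ι] (x : ι → ℝ) : 0 ≤ x ⬝ᵥ x :=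
  Finset.sum_nonneg fun i _ => mul_self_nonneg (x i)

section Probability

variable {Ω : Type*} [MeasurableSpace Ω] {μ : Measure Ω}

/-- If `f` and `g` are independent and the pair `(f, g)` is independent of `h`, then `f` is
independent of the pair `(g, h)`. -/
theorem indepFun_prodMk_of_indepFun_prodMk {α β γ : Type*} [MeasurableSpace α] [MeasurableSpace β]
    [MeasurableSpace γ] [IsProbabilityMeasure μ] {f : Ω → α} {g : Ω → β} {h : Ω → γ}
    (hf : Measurable f) (hg : Measurable g) (hh : Measurable h)
    (hfg : IndepFun f g μ) (hfgh : IndepFun (fun ω => (f ω, g ω)) h μ) :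
    IndepFun f (fun ω => (g ω, h ω)) μ := by
  have hgh : IndepFun g h μ := hfgh.comp measurable_snd measurable_id
  rw [indepFun_iff_map_prod_eq_prod_map_map (by fun_prop) (by fun_prop)] at hfg hgh hfgh ⊢
  have : IsProbabilityMeasure (μ.map f) := Measure.isProbabilityMeasure_map hf.aemeasurable
  have : IsProbabilityMeasure (μ.map g) := Measure.isProbabilityMeasure_map hg.aemeasurable
  have : IsProbabilityMeasure (μ.map h) := Measure.isProbabilityMeasure_map hh.aemeasurable
  have hassoc := (measurePreserving_prodAssoc (μ.map f) (μ.map g) (μ.map h)).map_eq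
  rw [hgh, ← hassoc, ← hfg, ← hfgh, Measure.map_map (by fun_prop) (by fun_prop)]
  rfl

/-- The mean square `E |f|²` of a random vector, with values in `[0, ∞]`. -/
def meanSq {ι : Type*} [Fintype ι] (μ : Measure Ω) (f : Ω → ι → ℝ) : ℝ≥0∞ :=
  ∫⁻ ω, ENNReal.ofReal (f ω ⬝ᵥ f ω) ∂μ

theorem meanSq_eq_sum {ι : Type*} [Fintype ι] {f : Ω → ι → ℝ} (hf : Measurable f) :
    meanSq μ f = ∑ i, ∫⁻ ω, ENNReal.ofReal (f ω i ^ 2) ∂μ := by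
  have hm : ∀ i, Measurable fun ω => f ω i := fun i => (measurable_pi_apply i).comp hf
  rw [meanSq, ← lintegral_finsetSum _ fun i _ => by have := hm i; fun_prop]
  refine lintegral_congr fun ω => ?_
  rw [← ENNReal.ofReal_sum_of_nonneg fun i _ => sq_nonneg _]
  simp only [dotProduct, sq]

/-- Pythagoras for independent real random variables, one of which is square integrable and
centred. The other one is arbitrary, and both sides may be infinite. -/
theorem lintegral_sq_add_of_indepFun [IsProbabilityMeasure μ] {e f : Ω → ℝ}
    (he : MemLp e 2 μ) (he0 : ∫ ω, e ω ∂μ = 0) (hf : Measurable f) (hef : IndepFun e f μ) :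
    ∫⁻ ω, ENNReal.ofReal ((e ω + f ω) ^ 2) ∂μ =
      ∫⁻ ω, ENNReal.ofReal (e ω ^ 2) ∂μ + ∫⁻ ω, ENNReal.ofReal (f ω ^ 2) ∂μ := by
  have infinite : ∀ g : Ω → ℝ, AEStronglyMeasurable g μ → ¬ MemLp g 2 μ →
      ∫⁻ ω, ENNReal.ofReal (g ω ^ 2) ∂μ = ∞ := by
    intro g hg hn
    by_contra h
    refine hn ((memLp_two_iff_integrable_sq hg).2 ⟨by fun_prop, ?_⟩)
    rw [hasFiniteIntegral_iff_ofReal (.of_forall fun ω => sq_nonneg _)]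
    exact lt_top_iff_ne_top.2 h
  by_cases hf2 : MemLp f 2 μ
  · have hef2 : MemLp (fun ω => e ω + f ω) 2 μ := he.add hf2
    have hcross : Integrable (fun ω => e ω * f ω) μ := he.integrable_mul hf2
    rw [← ofReal_integral_eq_lintegral_ofReal hef2.integrable_sq (.of_forall fun ω => sq_nonneg _),
      ← ofReal_integral_eq_lintegral_ofReal he.integrable_sq (.of_forall fun ω => sq_nonneg _),
      ← ofReal_integral_eq_lintegral_ofReal hf2.integrable_sq (.of_forall fun ω => sq_nonneg _),
      ← ENNReal.ofReal_add (integral_nonneg fun ω => sq_nonneg _)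
        (integral_nonneg fun ω => sq_nonneg _)]
    have h0 : ∫ ω, e ω * f ω ∂μ = 0 := by
      rw [hef.integral_fun_mul_eq_mul_integral he.1 hf2.1, he0, zero_mul]
    have hexp : (fun ω => (e ω + f ω) ^ 2) = fun ω => (e ω ^ 2 + f ω ^ 2) + 2 * (e ω * f ω) := by
      funext ω; ring
    rw [hexp, integral_add (by exact he.integrable_sq.add hf2.integrable_sq) (hcross.const_mul 2),
      integral_add he.integrable_sq hf2.integrable_sq, integral_const_mul, h0, mul_zero, add_zero]
  · rw [infinite f hf.aestronglyMeasurable hf2, add_top]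
    refine infinite _ (he.1.add hf.aestronglyMeasurable) fun h => hf2 ?_
    have := h.sub he
    simpa [Pi.sub_def] using this

/-- Pythagoras for independent random vectors, one of which is square integrable and centred. -/
theorem meanSq_add_of_indepFun [IsProbabilityMeasure μ] {ι : Type*} [Fintype ι]
    {e f : Ω → ι → ℝ} (hem : Measurable e) (he : ∀ i, MemLp (fun ω => e ω i) 2 μ)
    (he0 : ∀ i, ∫ ω, e ω i ∂μ = 0) (hf : Measurable f) (hef : IndepFun e f μ) :
    meanSq μ (fun ω => e ω + f ω) = meanSq μ e + meanSq μ f := by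
  rw [meanSq_eq_sum (f := fun ω => e ω + f ω) (hem.add hf), meanSq_eq_sum hem,
    meanSq_eq_sum hf, ← Finset.sum_add_distrib]
  refine Finset.sum_congr rfl fun i _ => ?_
  exact lintegral_sq_add_of_indepFun (he i) (he0 i) ((measurable_pi_apply i).comp hf)
    (hef.comp (measurable_pi_apply i) (measurable_pi_apply i))

theorem meanSq_ne_top {ι : Type*} [Fintype ι] {f : Ω → ι → ℝ} (hm : Measurable f)
    (hf : ∀ i, MemLp (fun ω => f ω i) 2 μ) : meanSq μ f ≠ ∞ := by
  rw [meanSq_eq_sum hm]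
  refine ENNReal.sum_ne_top.2 fun i _ => ?_
  rw [← ofReal_integral_eq_lintegral_ofReal (hf i).integrable_sq (.of_forall fun ω => sq_nonneg _)]
  exact ENNReal.ofReal_ne_top

theorem measurable_mulVec {ι κ : Type*} [Fintype ι] [Fintype κ] (P : Matrix κ ι ℝ) :
    Measurable fun x : ι → ℝ => P *ᵥ x :=
  (continuous_const.matrix_mulVec continuous_id).measurable

theorem _root_.Measurable.mulVec {α ι κ : Type*} {mα : MeasurableSpace α} [Fintype ι] [Fintype κ]
    {f : α → ι → ℝ} (hf : Measurable f) (P : Matrix κ ι ℝ) : Measurable fun a => P *ᵥ f a :=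
  (measurable_mulVec P).comp hf

theorem memLp_mulVec {ι κ : Type*} [Fintype ι] [Fintype κ] {f : Ω → ι → ℝ}
    (hf : ∀ i, MemLp (fun ω => f ω i) 2 μ) (P : Matrix κ ι ℝ) (k : κ) :
    MemLp (fun ω => (P *ᵥ f ω) k) 2 μ :=
  memLp_finsetSum _ fun i _ => (hf i).const_mul (P k i)

theorem integral_mulVec_eq_zero [IsProbabilityMeasure μ] {ι κ : Type*} [Fintype ι] [Fintype κ]
    {f : Ω → ι → ℝ} (hf : ∀ i, MemLp (fun ω => f ω i) 2 μ) (h0 : ∀ i, ∫ ω, f ω i ∂μ = 0)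
    (P : Matrix κ ι ℝ) (k : κ) : ∫ ω, (P *ᵥ f ω) k ∂μ = 0 := by
  simp only [mulVec, dotProduct]
  rw [integral_finsetSum _ fun i _ => ((hf i).integrable one_le_two).const_mul _]
  simp [integral_const_mul, h0]

/-! ### Cross-covariance matrices and centred Gaussian vectors -/

/-- The matrix of covariances of the coordinates of two random vectors. -/
def crossCov {ι κ : Type*} (μ : Measure Ω) (X : Ω → ι → ℝ) (Y : Ω → κ → ℝ) : Matrix ι κ ℝ :=
  Matrix.of fun i k => cov[fun ω => X ω i, fun ω => Y ω k; μ]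

section CrossCov

variable {ι κ σ : Type*} {X X' : Ω → ι → ℝ} {Y : Ω → κ → ℝ}

theorem crossCov_eq_zero_of_indepFun (hX : ∀ i, MemLp (fun ω => X ω i) 2 μ)
    (hY : ∀ k, MemLp (fun ω => Y ω k) 2 μ) (h : IndepFun X Y μ) : crossCov μ X Y = 0 := by
  ext i k
  exact (h.comp (measurable_pi_apply i) (measurable_pi_apply k)).covariance_eq_zero (hX i) (hY k)

theorem crossCov_transpose : (crossCov μ X Y)ᵀ = crossCov μ Y X := by
  ext i k
  exact covariance_comm _ _

variable [IsProbabilityMeasure μ]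

theorem crossCov_add_left (hX : ∀ i, MemLp (fun ω => X ω i) 2 μ)
    (hX' : ∀ i, MemLp (fun ω => X' ω i) 2 μ) (hY : ∀ k, MemLp (fun ω => Y ω k) 2 μ) :
    crossCov μ (fun ω => X ω + X' ω) Y = crossCov μ X Y + crossCov μ X' Y := by
  ext i k
  exact covariance_add_left (hX i) (hX' i) (hY k)

theorem crossCov_sub_left (hX : ∀ i, MemLp (fun ω => X ω i) 2 μ)
    (hX' : ∀ i, MemLp (fun ω => X' ω i) 2 μ) (hY : ∀ k, MemLp (fun ω => Y ω k) 2 μ) :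
    crossCov μ (fun ω => X ω - X' ω) Y = crossCov μ X Y - crossCov μ X' Y := by
  ext i k
  exact covariance_fun_sub_left (hX i) (hX' i) (hY k)

theorem crossCov_mulVec_left [Fintype ι] (hX : ∀ i, MemLp (fun ω => X ω i) 2 μ)
    (hY : ∀ k, MemLp (fun ω => Y ω k) 2 μ) (P : Matrix σ ι ℝ) :
    crossCov μ (fun ω => P *ᵥ X ω) Y = P * crossCov μ X Y := by
  ext s k
  simp only [crossCov, of_apply, mul_apply, mulVec, dotProduct]
  rw [covariance_fun_sum_left (fun i => (hX i).const_mul _) (hY k)]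
  simp only [covariance_const_mul_left]

theorem crossCov_add_right (hX : ∀ i, MemLp (fun ω => X ω i) 2 μ)
    (hX' : ∀ i, MemLp (fun ω => X' ω i) 2 μ) (hY : ∀ k, MemLp (fun ω => Y ω k) 2 μ) :
    crossCov μ Y (fun ω => X ω + X' ω) = crossCov μ Y X + crossCov μ Y X' := by
  rw [← crossCov_transpose, crossCov_add_left hX hX' hY, transpose_add, crossCov_transpose,
    crossCov_transpose]

theorem crossCov_sub_right (hX : ∀ i, MemLp (fun ω => X ω i) 2 μ)
    (hX' : ∀ i, MemLp (fun ω => X' ω i) 2 μ) (hY : ∀ k, MemLp (fun ω => Y ω k) 2 μ) :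
    crossCov μ Y (fun ω => X ω - X' ω) = crossCov μ Y X - crossCov μ Y X' := by
  rw [← crossCov_transpose, crossCov_sub_left hX hX' hY, transpose_sub, crossCov_transpose,
    crossCov_transpose]

theorem crossCov_mulVec_right [Fintype ι] (hX : ∀ i, MemLp (fun ω => X ω i) 2 μ)
    (hY : ∀ k, MemLp (fun ω => Y ω k) 2 μ) (P : Matrix σ ι ℝ) :
    crossCov μ Y (fun ω => P *ᵥ X ω) = crossCov μ Y X * Pᵀ := by
  rw [← crossCov_transpose, crossCov_mulVec_left hX hY, transpose_mul, crossCov_transpose]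

end CrossCov

/-- `X` is a Gaussian vector with mean zero and covariance matrix `S`. -/
structure IsCenteredGaussian {ι : Type*} [Fintype ι] (μ : Measure Ω) (X : Ω → ι → ℝ)
    (S : Matrix ι ι ℝ) : Prop where
  measurable : Measurable X
  hasGaussianLaw : HasGaussianLaw X μ
  integral_eq_zero : ∀ i, ∫ ω, X ω i ∂μ = 0
  crossCov_self : crossCov μ X X = S

theorem IsCenteredGaussian.memLp {ι : Type*} [Fintype ι] {X : Ω → ι → ℝ} {S : Matrix ι ι ℝ}
    (h : IsCenteredGaussian μ X S) (i : ι) : MemLp (fun ω => X ω i) 2 μ :=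
  (HasGaussianLaw.eval (X := fun i ω => X ω i) h.hasGaussianLaw i).memLp_two

theorem isCenteredGaussian_of_map_eq {ι : Type*} [Fintype ι] [DecidableEq ι] {X : Ω → ι → ℝ}
    {S : Matrix ι ι ℝ} (hS : S.PosSemidef) (hX : Measurable X)
    (hlaw : μ.map (fun ω => WithLp.toLp 2 (X ω)) = multivariateGaussian 0 S) :
    IsCenteredGaussian μ X S := by
  have hm : Measurable fun ω => WithLp.toLp 2 (X ω) := by fun_prop
  have hg : HasGaussianLaw (fun ω => WithLp.toLp 2 (X ω)) μ := ⟨by rw [hlaw]; infer_instance⟩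
  refine ⟨hX, hg.map_equiv (PiLp.continuousLinearEquiv 2 ℝ fun _ : ι => ℝ), fun i => ?_, ?_⟩
  · have h1 : ∫ x : EuclideanSpace ℝ ι, x i ∂(multivariateGaussian 0 S) = 0 := by
      have := (EuclideanSpace.proj (𝕜 := ℝ) i).integral_comp_id_comm
        (μ := multivariateGaussian (0 : EuclideanSpace ℝ ι) S) IsGaussian.integrable_id
      rw [integral_id_multivariateGaussian, map_zero] at this
      exact this
    rw [← hlaw, integral_map hm.aemeasurable (by fun_prop)] at h1
    exact h1
  · ext i j
    rw [← covariance_eval_multivariateGaussian (μ := 0) hS i j, ← hlaw,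
      covariance_map (by fun_prop) (by fun_prop) hm.aemeasurable]
    rfl

end Probability

/-! ### One step of the Kalman filter -/

section KalmanStep

variable {Ω : Type*} [MeasurableSpace Ω] {μ : Measure Ω} [IsProbabilityMeasure μ]
  {ι κ β : Type*} [Fintype ι] [Fintype κ] [MeasurableSpace β]

/-- Left multiplication by a matrix as a continuous linear map. -/
def mulVecCLM (P : Matrix κ ι ℝ) : (ι → ℝ) →L[ℝ] (κ → ℝ) :=
  LinearMap.toContinuousLinearMap P.mulVecLin

/-- Measurement update. The prior error `X`, independent of the past `H`, is measured through
`I = C X + V`. The posterior error `E = X - L I` is uncorrelated with `I` for the Kalman gain `L`,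
hence independent of it, and then also of the past enlarged by `I`. -/
theorem kalman_update [DecidableEq ι] [DecidableEq κ] {X : Ω → ι → ℝ} {V : Ω → κ → ℝ} {H : Ω → β}
    {P : Matrix ι ι ℝ} {R : Matrix κ κ ℝ} (hX : IsCenteredGaussian μ X P)
    (hV : IsCenteredGaussian μ V R) (hH : Measurable H) (hXH : IndepFun X H μ)
    (hXHV : IndepFun (fun ω => (X ω, H ω)) V μ) {C : Matrix κ ι ℝ} {L : Matrix ι κ ℝ}
    (hS : IsUnit (C * P * Cᵀ + R)) (hL : L = P * Cᵀ * (C * P * Cᵀ + R)⁻¹) :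
    IsCenteredGaussian μ (fun ω => X ω - L *ᵥ (C *ᵥ X ω + V ω)) ((1 - L * C) * P) ∧
      IndepFun (fun ω => X ω - L *ᵥ (C *ᵥ X ω + V ω)) (fun ω => (H ω, C *ᵥ X ω + V ω)) μ ∧
      IndepFun (fun ω => C *ᵥ X ω + V ω) H μ := by
  have hXm := hX.measurable
  have hVm := hV.measurable
  have hXV : IndepFun X V μ := hXHV.comp measurable_fst measurable_id
  set I : Ω → κ → ℝ := fun ω => C *ᵥ X ω + V ω with hI
  set E : Ω → ι → ℝ := fun ω => X ω - L *ᵥ I ω with hE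
  have hIm : Measurable I := (hXm.mulVec C).add hVm
  have hEm : Measurable E := hXm.sub (hIm.mulVec L)
  let ΦI : (ι → ℝ) × (κ → ℝ) →L[ℝ] (κ → ℝ) :=
    (mulVecCLM C).comp (.fst ℝ _ _) + .snd ℝ _ _
  let ΦE : (ι → ℝ) × (κ → ℝ) →L[ℝ] (ι → ℝ) :=
    .fst ℝ _ _ - (mulVecCLM L).comp ΦI
  have hgauss : HasGaussianLaw (fun ω => (E ω, I ω)) μ :=
    (hXV.hasGaussianLaw hX.hasGaussianLaw hV.hasGaussianLaw).map (ΦE.prod ΦI)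
  have hX2 := hX.memLp
  have hV2 := hV.memLp
  have hCX2 := memLp_mulVec hX2 C
  have hI2 : ∀ k, MemLp (fun ω => I ω k) 2 μ := fun k => (hCX2 k).add (hV2 k)
  have hLI2 := memLp_mulVec hI2 L
  have hE2 : ∀ i, MemLp (fun ω => E ω i) 2 μ := fun i => (hX2 i).sub (hLI2 i)
  have hcXV : crossCov μ X V = 0 := crossCov_eq_zero_of_indepFun hX2 hV2 hXV
  have hcVX : crossCov μ V X = 0 := crossCov_eq_zero_of_indepFun hV2 hX2 hXV.symm
  have hcXI : crossCov μ X I = P * Cᵀ := by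
    rw [hI, crossCov_add_right hCX2 hV2 hX2, crossCov_mulVec_right hX2 hX2, hX.crossCov_self, hcXV,
      add_zero]
  have hcIX : crossCov μ I X = C * P := by
    rw [hI, crossCov_add_left hCX2 hV2 hX2, crossCov_mulVec_left hX2 hX2, hX.crossCov_self, hcVX,
      add_zero]
  have hcVI : crossCov μ V I = R := by
    rw [hI, crossCov_add_right hCX2 hV2 hV2, crossCov_mulVec_right hX2 hV2, hV.crossCov_self, hcVX,
      Matrix.zero_mul, zero_add]
  have hcII : crossCov μ I I = C * P * Cᵀ + R := by
    conv_lhs => enter [2]; rw [hI]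
    rw [crossCov_add_left hCX2 hV2 hI2, crossCov_mulVec_left hX2 hI2, hcXI, hcVI,
      Matrix.mul_assoc]
  have hcEI : crossCov μ E I = 0 := by
    rw [hE, crossCov_sub_left hX2 hLI2 hI2, crossCov_mulVec_left hI2 hI2, hcXI, hcII, hL,
      nonsing_inv_mul_cancel_right _ _ ((isUnit_iff_isUnit_det _).1 hS), sub_self]
  have hcEX : crossCov μ E X = (1 - L * C) * P := by
    rw [hE, crossCov_sub_left hX2 hLI2 hX2, crossCov_mulVec_left hI2 hX2, hcIX, hX.crossCov_self,
      Matrix.sub_mul, Matrix.one_mul, Matrix.mul_assoc]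
  have hcEE : crossCov μ E E = (1 - L * C) * P := by
    conv_lhs => enter [3]; rw [hE]
    rw [crossCov_sub_right hX2 hLI2 hE2, crossCov_mulVec_right hI2 hE2, hcEI, hcEX,
      Matrix.zero_mul, sub_zero]
  have hEI : IndepFun E I μ := hgauss.indepFun_of_covariance_eval
    (X := fun i ω => E ω i) (Y := fun k ω => I ω k) fun i k => congrFun (congrFun hcEI i) k
  have hHXV : IndepFun H (fun ω => (X ω, V ω)) μ :=
    indepFun_prodMk_of_indepFun_prodMk hH hXm hVm hXH.symm
      (hXHV.comp measurable_swap measurable_id)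
  have hHEI : IndepFun H (fun ω => (E ω, I ω)) μ :=
    hHXV.comp (ψ := ΦE.prod ΦI) measurable_id (ΦE.prod ΦI).continuous.measurable
  refine ⟨⟨hEm, hgauss.fst, fun i => ?_, hcEE⟩, ?_, ?_⟩
  · have hI0 : ∀ k, ∫ ω, I ω k ∂μ = 0 := fun k => by
      simp only [hI, Pi.add_apply]
      rw [integral_add ((hCX2 k).integrable one_le_two) ((hV2 k).integrable one_le_two),
        integral_mulVec_eq_zero hX2 hX.integral_eq_zero, hV.integral_eq_zero, add_zero]
    simp only [hE, Pi.sub_apply]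
    rw [integral_sub ((hX2 i).integrable one_le_two) ((hLI2 i).integrable one_le_two),
      integral_mulVec_eq_zero hI2 hI0, hX.integral_eq_zero, sub_zero]
  · exact (indepFun_prodMk_of_indepFun_prodMk hEm hIm hH hEI hHEI.symm).comp
      measurable_id measurable_swap
  · exact hHEI.symm.comp measurable_snd measurable_id

/-- Time update: the error is propagated by the dynamics and perturbed by fresh noise. -/
theorem kalman_predict {E W : Ω → ι → ℝ} {H : Ω → β} {S Q : Matrix ι ι ℝ}
    (hE : IsCenteredGaussian μ E S) (hW : IsCenteredGaussian μ W Q) (hH : Measurable H)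
    (hEH : IndepFun E H μ) (hEHW : IndepFun (fun ω => (E ω, H ω)) W μ) (A : Matrix ι ι ℝ) :
    IsCenteredGaussian μ (fun ω => A *ᵥ E ω + W ω) (A * S * Aᵀ + Q) ∧
      IndepFun (fun ω => A *ᵥ E ω + W ω) H μ := by
  have hEm := hE.measurable
  have hWm := hW.measurable
  have hEW : IndepFun E W μ := hEHW.comp measurable_fst measurable_id
  have hE2 := hE.memLp
  have hW2 := hW.memLp
  have hAE2 := memLp_mulVec hE2 A
  have hcAEW : crossCov μ (fun ω => A *ᵥ E ω) W = 0 := by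
    rw [crossCov_mulVec_left hE2 hW2, crossCov_eq_zero_of_indepFun hE2 hW2 hEW, Matrix.mul_zero]
  have hcWAE : crossCov μ W (fun ω => A *ᵥ E ω) = 0 := by
    rw [← crossCov_transpose, hcAEW, transpose_zero]
  let Φ : (ι → ℝ) × (ι → ℝ) →L[ℝ] (ι → ℝ) := (mulVecCLM A).comp (.fst ℝ _ _) + .snd ℝ _ _
  refine ⟨⟨(hEm.mulVec A).add hWm,
    (hEW.hasGaussianLaw hE.hasGaussianLaw hW.hasGaussianLaw).map Φ, fun i => ?_, ?_⟩, ?_⟩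
  · simp only [Pi.add_apply]
    rw [integral_add ((hAE2 i).integrable one_le_two) ((hW2 i).integrable one_le_two),
      integral_mulVec_eq_zero hE2 hE.integral_eq_zero, hW.integral_eq_zero, add_zero]
  · have hsum2 : ∀ i, MemLp (fun ω => (A *ᵥ E ω + W ω) i) 2 μ := fun i => (hAE2 i).add (hW2 i)
    rw [crossCov_add_left hAE2 hW2 hsum2, crossCov_add_right hAE2 hW2 hAE2,
      crossCov_add_right hAE2 hW2 hW2, hcAEW, hcWAE, hW.crossCov_self,
      crossCov_mulVec_left hE2 hAE2, crossCov_mulVec_right hE2 hE2, hE.crossCov_self,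
      add_zero, zero_add, Matrix.mul_assoc]
  · have hHEW : IndepFun H (fun ω => (E ω, W ω)) μ :=
      indepFun_prodMk_of_indepFun_prodMk hH hEm hWm hEH.symm
        (hEHW.comp measurable_swap measurable_id)
    exact (hHEW.comp (ψ := Φ) measurable_id Φ.continuous.measurable).symm

end KalmanStep

/-! ### Estimation errors and innovations -/

variable {n dx dc : ℕ} {du dy : Fin n → ℕ} (sys : LQGSystem n dx dc du dy)

/-- The one-step prediction error `X_t - (A Z_{t-1} + B U_{t-1})`. It does not depend on the
control strategy and is written as a function of the noise alone. -/
def predErr (x₁ : St dx) (w : ℕ → St dx) (v : ℕ → Vec dy) : ℕ → St dx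
  | 0 => x₁
  | t + 1 => sys.A *ᵥ (predErr x₁ w v t - sys.L t *ᵥ (sys.C *ᵥ predErr x₁ w v t + v t)) + w t

/-- The innovation `Y_t - C (A Z_{t-1} + B U_{t-1})`, a function of the noise alone. -/
def innov (x₁ : St dx) (w : ℕ → St dx) (v : ℕ → Vec dy) (t : ℕ) : Vec dy :=
  sys.C *ᵥ sys.predErr x₁ w v t + v t

/-- The filtering error `X_t - Z_t`, a function of the noise alone. -/
def filtErr (x₁ : St dx) (w : ℕ → St dx) (v : ℕ → Vec dy) (t : ℕ) : St dx :=
  sys.predErr x₁ w v t - sys.L t *ᵥ sys.innov x₁ w v t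

/-- The centralized estimate along the trajectory under the strategy `h`. -/
def estimate (h : CentralStrategy du dy) (x₁ : St dx) (w : ℕ → St dx) (v : ℕ → Vec dy) (t : ℕ) :
    St dx :=
  sys.Z t (sys.info h x₁ w v t).1 (sys.info h x₁ w v t).2

section Pathwise

variable (h : CentralStrategy du dy) (x₁ : St dx) (w : ℕ → St dx) (v : ℕ → Vec dy)

theorem state_succ (t : ℕ) : sys.state h x₁ w v (t + 1) =
    sys.A *ᵥ sys.state h x₁ w v t + sys.B *ᵥ sys.action h x₁ w v t + w t := rfl

theorem info_fst_zero : (sys.info h x₁ w v 0).1 0 = sys.C *ᵥ x₁ + v 0 := rfl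

theorem info_succ (t : ℕ) : sys.info h x₁ w v (t + 1) =
    (Fin.snoc (α := fun _ => Vec dy) (sys.info h x₁ w v t).1
      (sys.C *ᵥ sys.state h x₁ w v (t + 1) + v (t + 1)),
      Fin.snoc (α := fun _ => Vec du) (sys.info h x₁ w v t).2 (sys.action h x₁ w v t)) := rfl

theorem estimate_succ_eq (t : ℕ) : sys.estimate h x₁ w v (t + 1) =
    (1 - sys.L (t + 1) * sys.C) *ᵥ
        (sys.A *ᵥ sys.estimate h x₁ w v t + sys.B *ᵥ sys.action h x₁ w v t)
      + sys.L (t + 1) *ᵥ (sys.C *ᵥ sys.state h x₁ w v (t + 1) + v (t + 1)) := by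
  simp only [estimate, info_succ, Z, Fin.snoc_castSucc, Fin.snoc_last]

theorem state_eq_estimate_add_filtErr (t : ℕ) :
    sys.state h x₁ w v t = sys.estimate h x₁ w v t + sys.filtErr x₁ w v t := by
  induction t with
  | zero =>
    simp only [estimate, Z, info_fst_zero, filtErr, innov, predErr]
    change x₁ = _
    abel
  | succ t ih =>
    have hε : sys.predErr x₁ w v (t + 1) = sys.A *ᵥ sys.filtErr x₁ w v t + w t := rfl
    have hδ : sys.filtErr x₁ w v (t + 1) = sys.predErr x₁ w v (t + 1) -
        sys.L (t + 1) *ᵥ (sys.C *ᵥ sys.predErr x₁ w v (t + 1) + v (t + 1)) := rfl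
    rw [estimate_succ_eq, state_succ, ih, hδ, hε]
    simp only [sub_mulVec, one_mulVec, ← mulVec_mulVec, mulVec_add]
    abel

theorem predErr_succ (t : ℕ) : sys.predErr x₁ w v (t + 1) =
    sys.A *ᵥ sys.filtErr x₁ w v t + w t := rfl

theorem state_succ_eq_add_predErr (t : ℕ) : sys.state h x₁ w v (t + 1) =
    sys.A *ᵥ sys.estimate h x₁ w v t + sys.B *ᵥ sys.action h x₁ w v t
      + sys.predErr x₁ w v (t + 1) := by
  rw [state_succ, state_eq_estimate_add_filtErr, predErr_succ, mulVec_add]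
  abel

theorem observation_succ (t : ℕ) : sys.C *ᵥ sys.state h x₁ w v (t + 1) + v (t + 1) =
    sys.C *ᵥ (sys.A *ᵥ sys.estimate h x₁ w v t + sys.B *ᵥ sys.action h x₁ w v t)
      + sys.innov x₁ w v (t + 1) := by
  rw [state_succ_eq_add_predErr, innov, mulVec_add]
  abel

/-- The estimate is a fully observed controlled linear process driven by the innovations. -/
theorem estimate_succ (t : ℕ) : sys.estimate h x₁ w v (t + 1) =
    sys.A *ᵥ sys.estimate h x₁ w v t + sys.B *ᵥ sys.action h x₁ w v t
      + sys.L (t + 1) *ᵥ sys.innov x₁ w v (t + 1) := by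
  rw [estimate_succ_eq, observation_succ, sub_mulVec, one_mulVec, ← mulVec_mulVec,
    mulVec_add (sys.L (t + 1))]
  abel

end Pathwise

theorem measurable_Z (t : ℕ) : Measurable fun p : (Fin (t + 1) → Vec dy) × (Fin t → Vec du) =>
    sys.Z t p.1 p.2 := by
  induction t with
  | zero => exact ((measurable_pi_apply 0).comp measurable_fst).mulVec _
  | succ t ih =>
    have hpast : Measurable fun p : (Fin (t + 2) → Vec dy) × (Fin (t + 1) → Vec du) =>
        ((fun s : Fin (t + 1) => p.1 s.castSucc, fun s : Fin t => p.2 s.castSucc) :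
          (Fin (t + 1) → Vec dy) × (Fin t → Vec du)) := by fun_prop
    exact ((((ih.comp hpast).mulVec _).add
      (((measurable_pi_apply _).comp measurable_snd).mulVec _)).mulVec _).add
      (((measurable_pi_apply _).comp measurable_fst).mulVec _)

theorem measurable_finSnoc {Ω E : Type*} {m : MeasurableSpace Ω} [MeasurableSpace E] {t : ℕ}
    {f : Ω → Fin t → E} {g : Ω → E} (hf : Measurable f) (hg : Measurable g) :
    Measurable fun ω => Fin.snoc (α := fun _ => E) (f ω) (g ω) := by
  refine measurable_pi_iff.2 fun s => ?_
  induction s using Fin.lastCases with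
  | last => simpa using hg
  | cast s => simpa using! (measurable_pi_apply s).comp hf

section Measurability

variable {Ω : Type*} {m : MeasurableSpace Ω}
  {X₁ : Ω → St dx} {W : ℕ → Ω → St dx} {V : ℕ → Ω → Vec dy}

/-- The innovations up to time `t` determine the centralized information at time `t`,
under every strategy. -/
theorem measurable_info {h : CentralStrategy du dy} (hh : CentralAdmissible h) (t : ℕ)
    (hI : ∀ s ≤ t, Measurable fun ω => sys.innov (X₁ ω) (fun s => W s ω) (fun s => V s ω) s) :
    Measurable fun ω => sys.info h (X₁ ω) (fun s => W s ω) (fun s => V s ω) t := by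
  induction t with
  | zero =>
    refine Measurable.prodMk (measurable_pi_iff.2 fun s => ?_)
      (measurable_pi_iff.2 fun s => s.elim0)
    obtain rfl : s = 0 := Fin.fin_one_eq_zero s
    exact hI 0 le_rfl
  | succ t ih =>
    have hinfo := ih fun s hs => hI s (hs.trans t.le_succ)
    have hact : Measurable fun ω => sys.action h (X₁ ω) (fun s => W s ω) (fun s => V s ω) t :=
      (hh t).comp hinfo
    have hest : Measurable fun ω => sys.estimate h (X₁ ω) (fun s => W s ω) (fun s => V s ω) t :=
      (sys.measurable_Z t).comp hinfo
    simp only [info_succ, observation_succ]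
    exact (measurable_finSnoc (measurable_fst.comp hinfo)
      ((((hest.mulVec _).add (hact.mulVec _)).mulVec _).add (hI _ le_rfl))).prodMk
      (measurable_finSnoc (measurable_snd.comp hinfo) hact)

theorem measurable_predErr (t : ℕ) (hX : Measurable X₁) (hW : ∀ s < t, Measurable (W s))
    (hV : ∀ s < t, Measurable (V s)) :
    Measurable fun ω => sys.predErr (X₁ ω) (fun s => W s ω) (fun s => V s ω) t := by
  induction t with
  | zero => exact hX
  | succ t ih =>
    have hε := ih (fun s hs => hW s (hs.trans t.lt_succ_self))
      (fun s hs => hV s (hs.trans t.lt_succ_self))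
    exact ((hε.sub (((hε.mulVec _).add (hV t t.lt_succ_self)).mulVec _)).mulVec _).add
      (hW t t.lt_succ_self)

theorem measurable_innov (t : ℕ) (hX : Measurable X₁) (hW : ∀ s < t, Measurable (W s))
    (hV : ∀ s ≤ t, Measurable (V s)) :
    Measurable fun ω => sys.innov (X₁ ω) (fun s => W s ω) (fun s => V s ω) t :=
  ((sys.measurable_predErr t hX hW fun s hs => hV s hs.le).mulVec _).add (hV t le_rfl)

theorem measurable_filtErr (t : ℕ) (hX : Measurable X₁) (hW : ∀ s < t, Measurable (W s))
    (hV : ∀ s ≤ t, Measurable (V s)) :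
    Measurable fun ω => sys.filtErr (X₁ ω) (fun s => W s ω) (fun s => V s ω) t :=
  (sys.measurable_predErr t hX hW fun s hs => hV s hs.le).sub
    ((sys.measurable_innov t hX hW hV).mulVec _)

end Measurability

/-! ### The Kalman filter -/

section Kalman

variable {Ω : Type*} [mΩ : MeasurableSpace Ω] {μ : Measure Ω} {T : ℕ}
  {X₁ : Ω → St dx} {W : ℕ → Ω → St dx} {V : ℕ → Ω → Vec dy}

/-- The σ-algebra of `X₁`, the first `a` process noises and the first `b` observation noises. -/
abbrev noiseSigma (X₁ : Ω → St dx) (W : ℕ → Ω → St dx) (V : ℕ → Ω → Vec dy) (a b : ℕ) :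
    MeasurableSpace Ω :=
  MeasurableSpace.comap X₁ inferInstance ⊔ (⨆ s < a, MeasurableSpace.comap (W s) inferInstance) ⊔
    ⨆ s < b, MeasurableSpace.comap (V s) inferInstance

omit mΩ in
theorem measurable_noiseSigma_init (a b : ℕ) : Measurable[noiseSigma X₁ W V a b] X₁ :=
  measurable_iff_comap_le.2 (le_sup_left.trans le_sup_left)

omit mΩ in
theorem measurable_noiseSigma_process {a b s : ℕ} (hs : s < a) :
    Measurable[noiseSigma X₁ W V a b] (W s) :=
  measurable_iff_comap_le.2 (le_sup_of_le_left (le_sup_of_le_right (le_iSup₂_of_le s hs le_rfl)))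

omit mΩ in
theorem measurable_noiseSigma_observation {a b s : ℕ} (hs : s < b) :
    Measurable[noiseSigma X₁ W V a b] (V s) :=
  measurable_iff_comap_le.2 (le_sup_of_le_right (le_iSup₂_of_le s hs le_rfl))

variable {sys}

/-- Noise variables that do not enter `noiseSigma X₁ W V a b` are independent of it. -/
theorem IsGaussianModel.indep_noiseSigma (hm : sys.IsGaussianModel T μ X₁ W V) {a b : ℕ}
    (ha : a ≤ T - 1) (hb : b ≤ T) (j : Fin (T - 1) ⊕ Fin T)
    (hj : ¬ Sum.elim (fun s : Fin (T - 1) => s.1 < a) (fun s : Fin T => s.1 < b) j) :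
    Indep (noiseSigma X₁ W V a b)
      (Sum.elim (fun t : Fin (T - 1) => MeasurableSpace.comap (W t) inferInstance)
        (fun t : Fin T => MeasurableSpace.comap (V t) inferInstance) j) μ := by
  let past : Set (Unit ⊕ Fin (T - 1) ⊕ Fin T) := {i | Sum.elim (fun _ => True)
    (Sum.elim (fun s : Fin (T - 1) => s.1 < a) (fun s : Fin T => s.1 < b)) i}
  have hdisj : Disjoint past {Sum.inr j} := Set.disjoint_singleton_right.2 hj
  have hle : ∀ i, Sum.elim (fun _ : Unit => MeasurableSpace.comap X₁ inferInstance)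
      (Sum.elim (fun t : Fin (T - 1) => MeasurableSpace.comap (W t) inferInstance)
        (fun t : Fin T => MeasurableSpace.comap (V t) inferInstance)) i ≤ mΩ := by
    rintro (_ | t | t)
    · exact hm.measX.comap_le
    · exact (hm.measW t).comap_le
    · exact (hm.measV t).comap_le
  have hind := indep_iSup_of_disjoint hle hm.indep hdisj
  rw [iSup_singleton] at hind
  refine indep_of_indep_of_le_left hind (sup_le (sup_le ?_ ?_) ?_)
  · exact le_iSup₂_of_le (Sum.inl ()) trivial le_rfl
  · exact iSup₂_le fun s hs =>
      le_iSup₂_of_le (Sum.inr (Sum.inl ⟨s, hs.trans_le ha⟩)) hs le_rfl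
  · exact iSup₂_le fun s hs =>
      le_iSup₂_of_le (Sum.inr (Sum.inr ⟨s, hs.trans_le hb⟩)) hs le_rfl

/-- A random variable that depends on the earlier noise only is independent of `V_t`. -/
theorem IsGaussianModel.indepFun_observationNoise (hm : sys.IsGaussianModel T μ X₁ W V)
    {α : Type*} [MeasurableSpace α] {f : Ω → α} {t : ℕ} (ht : t < T)
    (hf : Measurable[noiseSigma X₁ W V t t] f) : IndepFun f (V t) μ :=
  indep_of_indep_of_le_left
    (hm.indep_noiseSigma (Nat.le_sub_one_of_lt ht) ht.le (Sum.inr ⟨t, ht⟩) (lt_irrefl t))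
    hf.comap_le

/-- A random variable that depends on the earlier noise only is independent of `W_t`. -/
theorem IsGaussianModel.indepFun_processNoise (hm : sys.IsGaussianModel T μ X₁ W V)
    {α : Type*} [MeasurableSpace α] {f : Ω → α} {t : ℕ} (ht : t + 1 < T)
    (hf : Measurable[noiseSigma X₁ W V t (t + 1)] f) : IndepFun f (W t) μ :=
  indep_of_indep_of_le_left
    (hm.indep_noiseSigma (b := t + 1) (by omega) ht.le (Sum.inl ⟨t, by omega⟩) (lt_irrefl t))
    hf.comap_le

variable (sys)

/-- The innovations before time `t`. -/
def innovPast (X₁ : Ω → St dx) (W : ℕ → Ω → St dx) (V : ℕ → Ω → Vec dy) (t : ℕ) (ω : Ω) :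
    Fin t → Vec dy :=
  fun s => sys.innov (X₁ ω) (fun s => W s ω) (fun s => V s ω) s

omit mΩ in
theorem innovPast_succ (t : ℕ) (ω : Ω) : sys.innovPast X₁ W V (t + 1) ω =
    Fin.snoc (α := fun _ => Vec dy) (sys.innovPast X₁ W V t ω)
      (sys.innov (X₁ ω) (fun s => W s ω) (fun s => V s ω) t) := by
  funext s
  induction s using Fin.lastCases with
  | last => simp [innovPast]
  | cast s => simp [innovPast]

omit mΩ in
theorem measurable_innovPast {m : MeasurableSpace Ω} {t : ℕ}
    (hI : ∀ s < t, Measurable fun ω => sys.innov (X₁ ω) (fun s => W s ω) (fun s => V s ω) s) :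
    Measurable (sys.innovPast X₁ W V t) :=
  measurable_pi_iff.2 fun s => hI s s.2

variable {sys} [IsProbabilityMeasure μ]

/-- The Kalman filter: at each time the prediction error is centred Gaussian with covariance `P_t`
and independent of the past innovations; the innovation is independent of the past ones; and the
filtering error is centred Gaussian and independent of the innovations so far. -/
theorem IsGaussianModel.kalman (hm : sys.IsGaussianModel T μ X₁ W V)
    (hinn : ∀ t < T, IsUnit (sys.innovCov t)) {t : ℕ} (ht : t < T) :
    IsCenteredGaussian μ (fun ω => sys.predErr (X₁ ω) (fun s => W s ω) (fun s => V s ω) t)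
        (sys.predCov t) ∧
      IsCenteredGaussian μ (fun ω => sys.filtErr (X₁ ω) (fun s => W s ω) (fun s => V s ω) t)
        ((1 - sys.L t * sys.C) * sys.predCov t) ∧
      IndepFun (fun ω => sys.filtErr (X₁ ω) (fun s => W s ω) (fun s => V s ω) t)
        (sys.innovPast X₁ W V (t + 1)) μ ∧
      IndepFun (fun ω => sys.innov (X₁ ω) (fun s => W s ω) (fun s => V s ω) t)
        (sys.innovPast X₁ W V t) μ := by
  have hH : ∀ t, Measurable (sys.innovPast X₁ W V t) := fun t =>
    sys.measurable_innovPast fun s _ =>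
      sys.measurable_innov s hm.measX (fun r _ => hm.measW r) fun r _ => hm.measV r
  have update : ∀ {t}, t < T →
      IsCenteredGaussian μ (fun ω => sys.predErr (X₁ ω) (fun s => W s ω) (fun s => V s ω) t)
        (sys.predCov t) →
      IndepFun (fun ω => sys.predErr (X₁ ω) (fun s => W s ω) (fun s => V s ω) t)
        (sys.innovPast X₁ W V t) μ →
      IsCenteredGaussian μ (fun ω => sys.filtErr (X₁ ω) (fun s => W s ω) (fun s => V s ω) t)
        ((1 - sys.L t * sys.C) * sys.predCov t) ∧
      IndepFun (fun ω => sys.filtErr (X₁ ω) (fun s => W s ω) (fun s => V s ω) t)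
        (sys.innovPast X₁ W V (t + 1)) μ ∧
      IndepFun (fun ω => sys.innov (X₁ ω) (fun s => W s ω) (fun s => V s ω) t)
        (sys.innovPast X₁ W V t) μ := by
    intro t ht hε hεH
    have hindep : IndepFun (fun ω => (sys.predErr (X₁ ω) (fun s => W s ω) (fun s => V s ω) t,
        sys.innovPast X₁ W V t ω)) (V t) μ :=
      hm.indepFun_observationNoise ht
        ((sys.measurable_predErr t (measurable_noiseSigma_init t t)
          (fun s hs => measurable_noiseSigma_process hs)
          (fun s hs => measurable_noiseSigma_observation hs)).prodMk
        (sys.measurable_innovPast fun s hs => sys.measurable_innov s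
          (measurable_noiseSigma_init t t)
          (fun r hr => measurable_noiseSigma_process (hr.trans hs))
          fun r hr => measurable_noiseSigma_observation (hr.trans_lt hs)))
    obtain ⟨h1, h2, h3⟩ := kalman_update hε
      (isCenteredGaussian_of_map_eq hm.posV (hm.measV t) (hm.lawV ⟨t, ht⟩)) (hH t) hεH hindep
      (C := sys.C) (L := sys.L t) (hinn t ht) rfl
    refine ⟨h1, ?_, h3⟩
    have hsnoc : sys.innovPast X₁ W V (t + 1) =
        (fun p : (Fin t → Vec dy) × Vec dy => Fin.snoc (α := fun _ => Vec dy) p.1 p.2) ∘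
          fun ω => (sys.innovPast X₁ W V t ω,
            sys.innov (X₁ ω) (fun s => W s ω) (fun s => V s ω) t) :=
      funext fun ω => sys.innovPast_succ t ω
    rw [hsnoc]
    exact h2.comp measurable_id (measurable_finSnoc measurable_fst measurable_snd)
  have predict : ∀ {t}, t < T →
      IsCenteredGaussian μ (fun ω => sys.predErr (X₁ ω) (fun s => W s ω) (fun s => V s ω) t)
        (sys.predCov t) ∧
      IndepFun (fun ω => sys.predErr (X₁ ω) (fun s => W s ω) (fun s => V s ω) t)
        (sys.innovPast X₁ W V t) μ := by
    intro t
    induction t with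
    | zero =>
      intro _
      refine ⟨isCenteredGaussian_of_map_eq hm.posX hm.measX hm.lawX, ?_⟩
      have : sys.innovPast X₁ W V 0 = fun _ => Fin.elim0 := funext fun ω => funext fun s => s.elim0
      rw [this]
      exact indepFun_const_right _ _
    | succ t ih =>
      intro ht
      obtain ⟨hε, hεH⟩ := ih (t.lt_succ_self.trans ht)
      obtain ⟨hE, hEH, -⟩ := update (t.lt_succ_self.trans ht) hε hεH
      have hindep : IndepFun (fun ω => (sys.filtErr (X₁ ω) (fun s => W s ω) (fun s => V s ω) t,
          sys.innovPast X₁ W V (t + 1) ω)) (W t) μ := by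
        refine hm.indepFun_processNoise ht (Measurable.prodMk ?_
          (sys.measurable_innovPast fun s hs => ?_))
        · exact sys.measurable_filtErr t (measurable_noiseSigma_init _ _)
            (fun s hs => measurable_noiseSigma_process hs)
            fun s hs => measurable_noiseSigma_observation (Nat.lt_succ_of_le hs)
        · exact sys.measurable_innov s (measurable_noiseSigma_init _ _)
            (fun r hr => measurable_noiseSigma_process (hr.trans_le (Nat.le_of_lt_succ hs)))
            fun r hr => measurable_noiseSigma_observation (hr.trans_lt hs)
      exact kalman_predict hE
        (isCenteredGaussian_of_map_eq hm.posW (hm.measW t) (hm.lawW ⟨t, by omega⟩)) (hH _) hEH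
        hindep sys.A
  obtain ⟨hε, hεH⟩ := predict ht
  exact ⟨hε, update ht hε hεH⟩

end Kalman

/-! ### Linear-quadratic control of the estimate -/

/-- The least squares problem of minimizing `|R x + P u|²` over `u` is solved by `u = K x` with
`K = -P† R`, and its value is the square of the residual `(R + P K) x`, which is orthogonal to the
range of `P`. -/
theorem exists_leastSquares_gain {κ ι σ : Type*} [Fintype κ] [Fintype ι] [Fintype σ]
    [DecidableEq σ] (R : Matrix κ ι ℝ) (P : Matrix κ σ ℝ) :
    ∃ K : Matrix σ ι ℝ, ∀ x u,
      ((R + P * K) *ᵥ x) ⬝ᵥ ((R + P * K) *ᵥ x) ≤ (R *ᵥ x + P *ᵥ u) ⬝ᵥ (R *ᵥ x + P *ᵥ u) := by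
  obtain ⟨h1, -, h3, -⟩ := pinv_penrose P
  have hPT : Pᵀ * (P * pinv P) = Pᵀ := by
    rw [← h3, ← transpose_mul, h1]
  refine ⟨-(pinv P * R), fun x u => ?_⟩
  set K := -(pinv P * R) with hK
  have horth : Pᵀ * (R + P * K) = 0 := by
    rw [hK, Matrix.mul_neg, ← Matrix.mul_assoc P, Matrix.mul_add, Matrix.mul_neg,
      ← Matrix.mul_assoc Pᵀ, hPT, add_neg_cancel]
  have hsplit : R *ᵥ x + P *ᵥ u = (R + P * K) *ᵥ x + P *ᵥ (u - K *ᵥ x) := by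
    rw [add_mulVec, mulVec_sub, ← mulVec_mulVec]
    abel
  have hcross : ((R + P * K) *ᵥ x) ⬝ᵥ (P *ᵥ (u - K *ᵥ x)) = 0 := by
    rw [dotProduct_mulVec, ← mulVec_transpose, mulVec_mulVec, horth, zero_mulVec, zero_dotProduct]
  rw [hsplit, add_dotProduct, dotProduct_add, dotProduct_add, hcross,
    dotProduct_comm (P *ᵥ (u - K *ᵥ x)) ((R + P * K) *ᵥ x), hcross]
  have := dotProduct_self_nonneg_real (P *ᵥ (u - K *ᵥ x))
  linarith

/-- One step of dynamic programming: for the value function `|G x|²` at the next time, the optimal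
action is linear in `x`, and the value function is again of the form `|G' x|²`. -/
theorem exists_bellman_gain {κ : Type*} [Fintype κ] (G : Matrix κ (Fin dx) ℝ) :
    ∃ (K : Matrix (Σ i, Fin (du i)) (Fin dx) ℝ) (G' : Matrix (Fin dc ⊕ κ) (Fin dx) ℝ),
      (∀ x u, (G' *ᵥ x) ⬝ᵥ (G' *ᵥ x) ≤ sys.stageCost x u +
        (G *ᵥ (sys.A *ᵥ x + sys.B *ᵥ u)) ⬝ᵥ (G *ᵥ (sys.A *ᵥ x + sys.B *ᵥ u))) ∧
      ∀ x, (G' *ᵥ x) ⬝ᵥ (G' *ᵥ x) = sys.stageCost x (K *ᵥ x) +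
        (G *ᵥ (sys.A *ᵥ x + sys.B *ᵥ K *ᵥ x)) ⬝ᵥ (G *ᵥ (sys.A *ᵥ x + sys.B *ᵥ K *ᵥ x)) := by
  have hcost : ∀ x u, (fromRows sys.M (G * sys.A) *ᵥ x + fromRows sys.N (G * sys.B) *ᵥ u) ⬝ᵥ
      (fromRows sys.M (G * sys.A) *ᵥ x + fromRows sys.N (G * sys.B) *ᵥ u) =
      sys.stageCost x u +
        (G *ᵥ (sys.A *ᵥ x + sys.B *ᵥ u)) ⬝ᵥ (G *ᵥ (sys.A *ᵥ x + sys.B *ᵥ u)) := by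
    intro x u
    simp only [dotProduct, Fintype.sum_sum_type, fromRows_mulVec, Pi.add_apply, Sum.elim_inl,
      Sum.elim_inr, stageCost, mulVec_add, mulVec_mulVec]
  obtain ⟨K, hK⟩ := exists_leastSquares_gain (fromRows sys.M (G * sys.A))
    (fromRows sys.N (G * sys.B))
  refine ⟨K, _, fun x u => (hK x u).trans_eq (hcost x u), fun x => ?_⟩
  rw [add_mulVec, ← mulVec_mulVec]
  exact hcost x _

theorem stageCost_nonneg (x : St dx) (u : Vec du) : 0 ≤ sys.stageCost x u :=
  dotProduct_self_nonneg_real _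

section ControlledProcess

variable {Ω : Type*} [MeasurableSpace Ω] {μ : Measure Ω} {T : ℕ}

/-- A controlled process `Z_{t+1} = A Z_t + B U_t + ξ_{t+1}` whose perturbation is independent of
the earlier states and actions. -/
structure IsControlledProcess (μ : Measure Ω) (T : ℕ) (ξ Z : ℕ → Ω → St dx)
    (U : ℕ → Ω → Vec du) : Prop where
  measurable_state : ∀ t < T, Measurable (Z t)
  measurable_action : ∀ t < T, Measurable (U t)
  state_succ : ∀ t ω, Z (t + 1) ω = sys.A *ᵥ Z t ω + sys.B *ᵥ U t ω + ξ (t + 1) ω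
  indepFun : ∀ t, t + 1 < T → IndepFun (ξ (t + 1)) (fun ω => (Z t ω, U t ω)) μ

/-- The cost-to-go from time `t` of a fully observed controlled process. -/
def costToGo (μ : Measure Ω) (T : ℕ) (Z : ℕ → Ω → St dx) (U : ℕ → Ω → Vec du) (t : ℕ) : ℝ≥0∞ :=
  ∑ s ∈ Finset.Ico t T, ∫⁻ ω, ENNReal.ofReal (sys.stageCost (Z s ω) (U s ω)) ∂μ

variable {sys} in
theorem IsControlledProcess.measurable_stageCost {ξ Z : ℕ → Ω → St dx} {U : ℕ → Ω → Vec du}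
    (hZU : sys.IsControlledProcess μ T ξ Z U) {t : ℕ} (ht : t < T) :
    Measurable fun ω => sys.stageCost (Z t ω) (U t ω) := by
  have hr := ((hZU.measurable_state t ht).mulVec sys.M).add
    ((hZU.measurable_action t ht).mulVec sys.N)
  exact (continuous_id.dotProduct continuous_id).measurable.comp hr

/-- Backward dynamic programming. There are gains `K_t` and a value function `|G x|² + c` such that
the cost-to-go of every controlled process is at least `E |G Z_t|² + c`, with equality for
`U_s = K_s Z_s`. No integrability of the process is needed, since all quantities live in `[0, ∞]`.
The clause on `G` at the horizon records that there is no terminal cost, so that the perturbation at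
time `T` plays no role. -/
theorem exists_optimal_gains [IsProbabilityMeasure μ] {ξ : ℕ → Ω → St dx}
    (hξm : ∀ t < T, Measurable (ξ t)) (hξ2 : ∀ t < T, ∀ i, MemLp (fun ω => ξ t ω i) 2 μ)
    (hξ0 : ∀ t < T, ∀ i, ∫ ω, ξ t ω i ∂μ = 0) (k t : ℕ) (hk : t + k = T) :
    ∃ (K : ℕ → Matrix (Σ i, Fin (du i)) (Fin dx) ℝ) (κ : Type) (_ : Fintype κ)
      (G : Matrix κ (Fin dx) ℝ) (c : ℝ≥0∞), c ≠ ∞ ∧ (k = 0 → G = 0) ∧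
      ∀ (Z : ℕ → Ω → St dx) (U : ℕ → Ω → Vec du), sys.IsControlledProcess μ T ξ Z U →
        meanSq μ (fun ω => G *ᵥ Z t ω) + c ≤ sys.costToGo μ T Z U t ∧
        ((∀ s ω, t ≤ s → U s ω = K s *ᵥ Z s ω) →
          sys.costToGo μ T Z U t = meanSq μ (fun ω => G *ᵥ Z t ω) + c) := by
  induction k generalizing t with
  | zero =>
    refine ⟨0, Fin 0, inferInstance, 0, 0, ENNReal.zero_ne_top, fun _ => rfl, fun Z U _ => ?_⟩
    obtain rfl : t = T := hk
    simp [costToGo, meanSq]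
  | succ k ih =>
    obtain ⟨K, κ, _, G, c, hc, hG0, hstep⟩ := ih (t + 1) (by omega)
    obtain ⟨Kt, G', hle, heq⟩ := sys.exists_bellman_gain G
    have ht : t < T := by omega
    have hξterm : meanSq μ (fun ω => G *ᵥ ξ (t + 1) ω) ≠ ∞ := by
      rcases Nat.eq_zero_or_pos k with hk0 | hk0
      -- At the last step the perturbation is unconstrained, but `G = 0`.
      · simp [hG0 hk0, meanSq]
      · exact meanSq_ne_top ((hξm (t + 1) (by omega)).mulVec G)
          (memLp_mulVec (hξ2 (t + 1) (by omega)) G)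
    refine ⟨Function.update K t Kt, Fin dc ⊕ κ, inferInstance, G',
      meanSq μ (fun ω => G *ᵥ ξ (t + 1) ω) + c, ENNReal.add_ne_top.2 ⟨hξterm, hc⟩,
      fun h => absurd h k.succ_ne_zero, fun Z U hZU => ?_⟩
    obtain ⟨hlow, hatt⟩ := hstep Z U hZU
    have hdrift : Measurable fun ω => sys.A *ᵥ Z t ω + sys.B *ᵥ U t ω :=
      ((hZU.measurable_state t ht).mulVec _).add ((hZU.measurable_action t ht).mulVec _)
    have hnext : meanSq μ (fun ω => G *ᵥ Z (t + 1) ω) = meanSq μ (fun ω => G *ᵥ ξ (t + 1) ω) +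
        meanSq μ (fun ω => G *ᵥ (sys.A *ᵥ Z t ω + sys.B *ᵥ U t ω)) := by
      rcases Nat.eq_zero_or_pos k with hk0 | hk0
      · simp [hG0 hk0, meanSq]
      · have ht1 : t + 1 < T := by omega
        rw [← meanSq_add_of_indepFun ((hξm _ ht1).mulVec G) (memLp_mulVec (hξ2 _ ht1) G)
          (integral_mulVec_eq_zero (hξ2 _ ht1) (hξ0 _ ht1) G) (hdrift.mulVec G)]
        · congr 1
          funext ω
          rw [hZU.state_succ, mulVec_add, add_comm]
        · have hφ : Measurable fun p : St dx × Vec du => G *ᵥ (sys.A *ᵥ p.1 + sys.B *ᵥ p.2) :=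
            ((measurable_fst.mulVec _).add (measurable_snd.mulVec _)).mulVec _
          exact (hZU.indepFun t ht1).comp (measurable_mulVec G) hφ
    have hsplit : sys.costToGo μ T Z U t =
        ∫⁻ ω, ENNReal.ofReal (sys.stageCost (Z t ω) (U t ω)) ∂μ +
          sys.costToGo μ T Z U (t + 1) := Finset.sum_eq_sum_Ico_succ_bot ht _
    have hjoin : ∫⁻ ω, ENNReal.ofReal (sys.stageCost (Z t ω) (U t ω)) ∂μ +
        meanSq μ (fun ω => G *ᵥ (sys.A *ᵥ Z t ω + sys.B *ᵥ U t ω)) =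
        ∫⁻ ω, ENNReal.ofReal (sys.stageCost (Z t ω) (U t ω) +
          (G *ᵥ (sys.A *ᵥ Z t ω + sys.B *ᵥ U t ω)) ⬝ᵥ
            (G *ᵥ (sys.A *ᵥ Z t ω + sys.B *ᵥ U t ω))) ∂μ := by
      rw [meanSq, ← lintegral_add_left (hZU.measurable_stageCost ht).ennreal_ofReal]
      refine lintegral_congr fun ω => ?_
      rw [ENNReal.ofReal_add (sys.stageCost_nonneg _ _) (dotProduct_self_nonneg_real _)]
    rw [hsplit]
    constructor
    · calc meanSq μ (fun ω => G' *ᵥ Z t ω) + (meanSq μ (fun ω => G *ᵥ ξ (t + 1) ω) + c)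
          ≤ (∫⁻ ω, ENNReal.ofReal (sys.stageCost (Z t ω) (U t ω)) ∂μ +
              meanSq μ (fun ω => G *ᵥ (sys.A *ᵥ Z t ω + sys.B *ᵥ U t ω))) +
              (meanSq μ (fun ω => G *ᵥ ξ (t + 1) ω) + c) := by
            rw [hjoin]
            gcongr
            exact lintegral_mono fun ω => ENNReal.ofReal_le_ofReal (hle _ _)
        _ = ∫⁻ ω, ENNReal.ofReal (sys.stageCost (Z t ω) (U t ω)) ∂μ +
              (meanSq μ (fun ω => G *ᵥ Z (t + 1) ω) + c) := by rw [hnext]; ring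
        _ ≤ _ := by gcongr
    · intro hU
      rw [hatt fun s ω hs => by rw [hU s ω (by omega), Function.update_of_ne (by omega)], hnext,
        add_comm (meanSq μ fun ω => G *ᵥ ξ (t + 1) ω), add_assoc, ← add_assoc, hjoin]
      congr 1
      refine lintegral_congr fun ω => ?_
      rw [hU t ω le_rfl, Function.update_self, heq]

end ControlledProcess

variable {sys}

/-! ### The centralized problem -/

section Central

variable {Ω : Type*} [mΩ : MeasurableSpace Ω] {μ : Measure Ω} [IsProbabilityMeasure μ] {T : ℕ}
  {X₁ : Ω → St dx} {W : ℕ → Ω → St dx} {V : ℕ → Ω → Vec dy}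

omit [IsProbabilityMeasure μ] in
theorem IsGaussianModel.measurable_innovPast (hm : sys.IsGaussianModel T μ X₁ W V) (t : ℕ) :
    Measurable (sys.innovPast X₁ W V t) :=
  sys.measurable_innovPast fun s _ =>
    sys.measurable_innov s hm.measX (fun r _ => hm.measW r) fun r _ => hm.measV r

omit mΩ in
theorem measurable_info_innovPast {h : CentralStrategy du dy} (hh : CentralAdmissible h) (t : ℕ) :
    Measurable[MeasurableSpace.comap (sys.innovPast X₁ W V (t + 1)) inferInstance]
      fun ω => sys.info h (X₁ ω) (fun s => W s ω) (fun s => V s ω) t :=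
  sys.measurable_info hh t fun s hs =>
    (measurable_pi_apply (⟨s, Nat.lt_succ_of_le hs⟩ : Fin (t + 1))).comp
      (comap_measurable (sys.innovPast X₁ W V (t + 1)))

omit [IsProbabilityMeasure μ] in
theorem IsGaussianModel.measurable_info (hm : sys.IsGaussianModel T μ X₁ W V)
    {h : CentralStrategy du dy} (hh : CentralAdmissible h) (t : ℕ) :
    Measurable fun ω => sys.info h (X₁ ω) (fun s => W s ω) (fun s => V s ω) t :=
  (measurable_info_innovPast hh t).mono (hm.measurable_innovPast (t + 1)).comap_le le_rfl

/-- The filtering error is independent of the centralized information, under every strategy. -/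
theorem IsGaussianModel.indepFun_filtErr_info (hm : sys.IsGaussianModel T μ X₁ W V)
    (hinn : ∀ t < T, IsUnit (sys.innovCov t)) {h : CentralStrategy du dy}
    (hh : CentralAdmissible h) {t : ℕ} (ht : t < T) :
    IndepFun (fun ω => sys.filtErr (X₁ ω) (fun s => W s ω) (fun s => V s ω) t)
      (fun ω => sys.info h (X₁ ω) (fun s => W s ω) (fun s => V s ω) t) μ :=
  indep_of_indep_of_le_right (hm.kalman hinn ht).2.2.1
    (measurable_info_innovPast hh t).comap_le

/-- The next innovation is independent of the centralized information, under every strategy. -/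
theorem IsGaussianModel.indepFun_innov_info (hm : sys.IsGaussianModel T μ X₁ W V)
    (hinn : ∀ t < T, IsUnit (sys.innovCov t)) {h : CentralStrategy du dy}
    (hh : CentralAdmissible h) {t : ℕ} (ht : t + 1 < T) :
    IndepFun (fun ω => sys.innov (X₁ ω) (fun s => W s ω) (fun s => V s ω) (t + 1))
      (fun ω => sys.info h (X₁ ω) (fun s => W s ω) (fun s => V s ω) t) μ :=
  indep_of_indep_of_le_right (hm.kalman hinn ht).2.2.2
    (measurable_info_innovPast hh t).comap_le

theorem IsGaussianModel.memLp_innov (hm : sys.IsGaussianModel T μ X₁ W V)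
    (hinn : ∀ t < T, IsUnit (sys.innovCov t)) {t : ℕ} (ht : t < T) (k : Σ i, Fin (dy i)) :
    MemLp (fun ω => sys.innov (X₁ ω) (fun s => W s ω) (fun s => V s ω) t k) 2 μ :=
  (memLp_mulVec (hm.kalman hinn ht).1.memLp sys.C k).add
    ((isCenteredGaussian_of_map_eq hm.posV (hm.measV t) (hm.lawV ⟨t, ht⟩)).memLp k)

theorem IsGaussianModel.integral_innov (hm : sys.IsGaussianModel T μ X₁ W V)
    (hinn : ∀ t < T, IsUnit (sys.innovCov t)) {t : ℕ} (ht : t < T) (k : Σ i, Fin (dy i)) :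
    ∫ ω, sys.innov (X₁ ω) (fun s => W s ω) (fun s => V s ω) t k ∂μ = 0 := by
  have hε := (hm.kalman hinn ht).1
  have hV := isCenteredGaussian_of_map_eq hm.posV (hm.measV t) (hm.lawV ⟨t, ht⟩)
  simp only [innov, Pi.add_apply]
  rw [integral_add ((memLp_mulVec hε.memLp sys.C k).integrable one_le_two)
    ((hV.memLp k).integrable one_le_two),
    integral_mulVec_eq_zero hε.memLp hε.integral_eq_zero, hV.integral_eq_zero, add_zero]

/-- Under every admissible strategy, the estimate is a controlled process driven by the
innovations. -/
theorem IsGaussianModel.isControlledProcess (hm : sys.IsGaussianModel T μ X₁ W V)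
    (hinn : ∀ t < T, IsUnit (sys.innovCov t)) {h : CentralStrategy du dy}
    (hh : CentralAdmissible h) :
    sys.IsControlledProcess μ T
      (fun t ω => sys.L t *ᵥ sys.innov (X₁ ω) (fun s => W s ω) (fun s => V s ω) t)
      (fun t ω => sys.estimate h (X₁ ω) (fun s => W s ω) (fun s => V s ω) t)
      (fun t ω => sys.action h (X₁ ω) (fun s => W s ω) (fun s => V s ω) t) where
  measurable_state t _ := (sys.measurable_Z t).comp (hm.measurable_info hh t)
  measurable_action t _ := (hh t).comp (hm.measurable_info hh t)
  state_succ t _ := sys.estimate_succ h _ _ _ t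
  indepFun t ht := (hm.indepFun_innov_info hinn hh ht).comp (measurable_mulVec _)
    ((sys.measurable_Z t).prodMk (hh t))

/-- Separation of estimation and control: since the filtering error is centred and independent of
the estimate and the action, the cost is the sum of a term that does not depend on the strategy and
of the cost of controlling the estimate. -/
theorem IsGaussianModel.expCost_eq (hm : sys.IsGaussianModel T μ X₁ W V)
    (hinn : ∀ t < T, IsUnit (sys.innovCov t)) {h : CentralStrategy du dy}
    (hh : CentralAdmissible h) :
    sys.expCost T μ X₁ W V h =
      ∑ t ∈ Finset.range T, meanSq μ (fun ω =>
        sys.M *ᵥ sys.filtErr (X₁ ω) (fun s => W s ω) (fun s => V s ω) t) +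
      sys.costToGo μ T (fun t ω => sys.estimate h (X₁ ω) (fun s => W s ω) (fun s => V s ω) t)
        (fun t ω => sys.action h (X₁ ω) (fun s => W s ω) (fun s => V s ω) t) 0 := by
  have hproc := hm.isControlledProcess hinn hh
  have hpath : ∀ t ω, sys.stageCost (sys.state h (X₁ ω) (fun s => W s ω) (fun s => V s ω) t)
      (sys.action h (X₁ ω) (fun s => W s ω) (fun s => V s ω) t) =
      (sys.M *ᵥ sys.filtErr (X₁ ω) (fun s => W s ω) (fun s => V s ω) t +
        (sys.M *ᵥ sys.estimate h (X₁ ω) (fun s => W s ω) (fun s => V s ω) t +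
          sys.N *ᵥ sys.action h (X₁ ω) (fun s => W s ω) (fun s => V s ω) t)) ⬝ᵥ
      (sys.M *ᵥ sys.filtErr (X₁ ω) (fun s => W s ω) (fun s => V s ω) t +
        (sys.M *ᵥ sys.estimate h (X₁ ω) (fun s => W s ω) (fun s => V s ω) t +
          sys.N *ᵥ sys.action h (X₁ ω) (fun s => W s ω) (fun s => V s ω) t)) := by
    intro t ω
    rw [stageCost, state_eq_estimate_add_filtErr, mulVec_add]
    congr 1 <;> abel
  have hres : ∀ t < T, Measurable fun ω =>
      sys.M *ᵥ sys.estimate h (X₁ ω) (fun s => W s ω) (fun s => V s ω) t +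
        sys.N *ᵥ sys.action h (X₁ ω) (fun s => W s ω) (fun s => V s ω) t := fun t ht =>
    ((hproc.measurable_state t ht).mulVec _).add ((hproc.measurable_action t ht).mulVec _)
  have herr : ∀ t < T, Measurable fun ω =>
      sys.M *ᵥ sys.filtErr (X₁ ω) (fun s => W s ω) (fun s => V s ω) t := fun t ht =>
    ((hm.kalman hinn ht).2.1.measurable).mulVec _
  have hterm : ∀ t ∈ Finset.range T, ∫⁻ ω, ENNReal.ofReal
      (sys.stageCost (sys.state h (X₁ ω) (fun s => W s ω) (fun s => V s ω) t)
        (sys.action h (X₁ ω) (fun s => W s ω) (fun s => V s ω) t)) ∂μ =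
      meanSq μ (fun ω => sys.M *ᵥ sys.filtErr (X₁ ω) (fun s => W s ω) (fun s => V s ω) t) +
      ∫⁻ ω, ENNReal.ofReal
        (sys.stageCost (sys.estimate h (X₁ ω) (fun s => W s ω) (fun s => V s ω) t)
          (sys.action h (X₁ ω) (fun s => W s ω) (fun s => V s ω) t)) ∂μ := by
    intro t ht
    have ht := Finset.mem_range.1 ht
    have hE := (hm.kalman hinn ht).2.1
    have hφ : Measurable fun p : (Fin (t + 1) → Vec dy) × (Fin t → Vec du) =>
        sys.M *ᵥ sys.Z t p.1 p.2 + sys.N *ᵥ h t p.1 p.2 :=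
      ((sys.measurable_Z t).mulVec _).add ((hh t).mulVec _)
    simp only [hpath]
    exact meanSq_add_of_indepFun (herr t ht) (memLp_mulVec hE.memLp _)
      (integral_mulVec_eq_zero hE.memLp hE.integral_eq_zero _) (hres t ht)
      ((hm.indepFun_filtErr_info hinn hh ht).comp (measurable_mulVec _) hφ)
  rw [costToGo, ← Finset.range_eq_Ico, ← Finset.sum_add_distrib, ← Finset.sum_congr rfl hterm,
    ← lintegral_finsetSum, expCost]
  · refine lintegral_congr fun ω => ?_
    rw [ENNReal.ofReal_sum_of_nonneg fun t _ => sys.stageCost_nonneg _ _]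
  · intro t ht
    have ht := Finset.mem_range.1 ht
    have hsum := (herr t ht).add (hres t ht)
    simp only [hpath]
    exact ((continuous_id.dotProduct continuous_id).measurable.comp hsum).ennreal_ofReal

theorem centralAdmissible_centralKZ (K : ℕ → Matrix (Σ i, Fin (du i)) (Fin dx) ℝ) :
    CentralAdmissible (sys.centralKZ K) :=
  fun t => (sys.measurable_Z t).mulVec (K t)

/-- The centralized problem has an optimal strategy `U_t = K_t Z_t`, and its cost is finite. -/
theorem IsGaussianModel.exists_centralOptimal (hm : sys.IsGaussianModel T μ X₁ W V)
    (hinn : ∀ t < T, IsUnit (sys.innovCov t)) :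
    ∃ K : ℕ → Matrix (Σ i, Fin (du i)) (Fin dx) ℝ,
      sys.CentralOptimal T μ X₁ W V (sys.centralKZ K) ∧
        sys.expCost T μ X₁ W V (sys.centralKZ K) ≠ ∞ := by
  have hξm : ∀ t < T, Measurable fun ω =>
      sys.L t *ᵥ sys.innov (X₁ ω) (fun s => W s ω) (fun s => V s ω) t := fun t _ =>
    (sys.measurable_innov t hm.measX (fun r _ => hm.measW r) fun r _ => hm.measV r).mulVec _
  have hξ2 : ∀ t < T, ∀ i, MemLp (fun ω =>
      (sys.L t *ᵥ sys.innov (X₁ ω) (fun s => W s ω) (fun s => V s ω) t) i) 2 μ := fun t ht =>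
    memLp_mulVec (hm.memLp_innov hinn ht) _
  obtain ⟨K, κ, _, G, c, hc, hG, hK⟩ := sys.exists_optimal_gains hξm hξ2
    (fun t ht => integral_mulVec_eq_zero (hm.memLp_innov hinn ht) (hm.integral_innov hinn ht) _)
    T 0 (zero_add T)
  have hadm := centralAdmissible_centralKZ (sys := sys) K
  have hopt := (hK _ _ (hm.isControlledProcess hinn hadm)).2 fun s ω _ => rfl
  refine ⟨K, ⟨hadm, fun h' hh' => ?_⟩, ?_⟩
  · rw [hm.expCost_eq hinn hadm, hm.expCost_eq hinn hh', hopt]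
    gcongr
    -- The initial estimate `L_1 Y_1` is the same for all strategies.
    exact (hK _ _ (hm.isControlledProcess hinn hh')).1
  · rw [hm.expCost_eq hinn hadm, hopt]
    refine ENNReal.add_ne_top.2 ⟨ENNReal.sum_ne_top.2 fun t ht => ?_,
      ENNReal.add_ne_top.2 ⟨?_, hc⟩⟩
    · have hE := (hm.kalman hinn (Finset.mem_range.1 ht)).2.1
      exact meanSq_ne_top (hE.measurable.mulVec _) (memLp_mulVec hE.memLp _)
    · rcases Nat.eq_zero_or_pos T with hT | hT
      · simp [hG hT, meanSq]
      · exact meanSq_ne_top ((hξm 0 hT).mulVec G) (memLp_mulVec (hξ2 0 hT) G)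

/-- Under linear feedback, the estimate is the conditional mean of the state. -/
theorem IsGaussianModel.estimate_ae_eq_condExp (hm : sys.IsGaussianModel T μ X₁ W V)
    (hinn : ∀ t < T, IsUnit (sys.innovCov t)) (K : ℕ → Matrix (Σ i, Fin (du i)) (Fin dx) ℝ)
    {t : ℕ} (ht : t < T) :
    (fun ω => sys.estimate (sys.centralKZ K) (X₁ ω) (fun s => W s ω) (fun s => V s ω) t) =ᵐ[μ]
      μ[fun ω => sys.state (sys.centralKZ K) (X₁ ω) (fun s => W s ω) (fun s => V s ω) t |
        MeasurableSpace.comap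
          (fun ω => sys.info (sys.centralKZ K) (X₁ ω) (fun s => W s ω) (fun s => V s ω) t)
          inferInstance] := by
  have hadm := centralAdmissible_centralKZ (sys := sys) K
  have hle := (hm.measurable_info hadm t).comap_le
  have hE := (hm.kalman hinn ht).2.1
  have hEint : Integrable (fun ω => sys.filtErr (X₁ ω) (fun s => W s ω) (fun s => V s ω) t) μ :=
    .of_eval fun i => (hE.memLp i).integrable one_le_two
  have hZ2 : ∀ t, t < T → ∀ i, MemLp (fun ω =>
      sys.estimate (sys.centralKZ K) (X₁ ω) (fun s => W s ω) (fun s => V s ω) t i) 2 μ := by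
    intro t
    induction t with
    | zero => exact fun ht => memLp_mulVec (hm.memLp_innov hinn ht) _
    | succ t ih =>
      intro ht i
      have hZ := ih (t.lt_succ_self.trans ht)
      simp only [estimate_succ]
      exact ((memLp_mulVec hZ _ i).add (memLp_mulVec (memLp_mulVec hZ (K t)) _ i)).add
        (memLp_mulVec (hm.memLp_innov hinn ht) _ i)
  have hZint : Integrable (fun ω =>
      sys.estimate (sys.centralKZ K) (X₁ ω) (fun s => W s ω) (fun s => V s ω) t) μ :=
    .of_eval fun i => (hZ2 t ht i).integrable one_le_two
  have hZm : StronglyMeasurable[MeasurableSpace.comap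
      (fun ω => sys.info (sys.centralKZ K) (X₁ ω) (fun s => W s ω) (fun s => V s ω) t)
      inferInstance] fun ω =>
        sys.estimate (sys.centralKZ K) (X₁ ω) (fun s => W s ω) (fun s => V s ω) t :=
    ((sys.measurable_Z t).comp (comap_measurable _)).stronglyMeasurable
  have hE0 : ∫ ω, sys.filtErr (X₁ ω) (fun s => W s ω) (fun s => V s ω) t ∂μ = 0 := by
    funext i
    rw [eval_integral fun i => (hE.memLp i).integrable one_le_two]
    exact hE.integral_eq_zero i
  have hEcond := condExp_indep_eq hE.measurable.comap_le hle
    (comap_measurable fun ω =>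
      sys.filtErr (X₁ ω) (fun s => W s ω) (fun s => V s ω) t).stronglyMeasurable
    (hm.indepFun_filtErr_info hinn hadm ht)
  have hadd := condExp_add hZint hEint (MeasurableSpace.comap
    (fun ω => sys.info (sys.centralKZ K) (X₁ ω) (fun s => W s ω) (fun s => V s ω) t) inferInstance)
  rw [condExp_of_stronglyMeasurable hle hZm hZint] at hadd
  simp only [state_eq_estimate_add_filtErr]
  refine (hadd.trans ?_).symm
  filter_upwards [hEcond] with ω hω
  rw [Pi.add_apply, hω, hE0, add_zero]

end Central

/-! ### The decentralized strategies -/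

theorem mulVec_eq_sum_colBlock {r : Type*} {d : Fin n → ℕ} (P : Matrix r (Σ i, Fin (d i)) ℝ)
    (z : Vec d) : P *ᵥ z = ∑ i, colBlock P i *ᵥ block i z := by
  funext k
  simp only [mulVec, dotProduct, Finset.sum_apply, Fintype.sum_sigma, colBlock, block,
    submatrix_apply, id]

theorem mulVec_embed {r : Type*} {d : Fin n → ℕ} (P : Matrix r (Σ i, Fin (d i)) ℝ) (i : Fin n)
    (v : Fin (d i) → ℝ) : P *ᵥ embed i v = colBlock P i *ᵥ v := by
  rw [mulVec_eq_sum_colBlock, Finset.sum_eq_single i]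
  · congr 1
    funext a
    simp [block, embed]
  · intro j _ hj
    have : block j (embed i v) = 0 := by
      funext a
      simp [block, embed, Pi.single_eq_of_ne hj]
    rw [this, mulVec_zero]
  · simp

/-- Substitutability says that `[B; N]` factors through `[B^i; N^i]` on the left, so that
`Λ^i = [B^i; N^i]† [B; N]` is such a factor. -/
theorem Substitutable.fromRows_mul_Lam (hsub : sys.Substitutable) (i : Fin n) :
    fromRows (colBlock sys.B i) (colBlock sys.N i) * sys.Lam i = fromRows sys.B sys.N := by
  obtain ⟨h1, -⟩ := pinv_penrose (fromRows (colBlock sys.B i) (colBlock sys.N i))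
  refine ext_of_mulVec_single fun q => ?_
  obtain ⟨v, hB, hN⟩ := hsub (Pi.single q 1) i
  have hv : fromRows sys.B sys.N *ᵥ Pi.single q 1 =
      fromRows (colBlock sys.B i) (colBlock sys.N i) *ᵥ v := by
    rw [fromRows_mulVec, fromRows_mulVec, hB, hN, mulVec_embed, mulVec_embed]
  rw [Lam, ← Matrix.mul_assoc, ← mulVec_mulVec, hv, mulVec_mulVec, h1]

theorem Substitutable.colBlock_B_mul_Lam (hsub : sys.Substitutable) (i : Fin n) :
    colBlock sys.B i * sys.Lam i = sys.B := by
  have h := hsub.fromRows_mul_Lam i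
  rw [fromRows_mul] at h
  exact (fromRows_inj h).1

theorem Substitutable.colBlock_N_mul_Lam (hsub : sys.Substitutable) (i : Fin n) :
    colBlock sys.N i * sys.Lam i = sys.N := by
  have h := hsub.fromRows_mul_Lam i
  rw [fromRows_mul] at h
  exact (fromRows_inj h).2

/-- The local filters add up to the centralized one. -/
theorem sum_S_eq_Z (t : ℕ) (ys : Fin (t + 1) → Vec dy) (us : Fin t → Vec du) :
    ∑ i, sys.S i t (fun s => block i (ys s)) (fun s => block i (us s)) = sys.Z t ys us := by
  induction t with
  | zero => exact (mulVec_eq_sum_colBlock _ _).symm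
  | succ t ih =>
    simp only [S, Z]
    rw [Finset.sum_add_distrib, ← mulVec_eq_sum_colBlock, ← Matrix.mulVec_sum,
      Finset.sum_add_distrib, ← mulVec_eq_sum_colBlock, ← Matrix.mulVec_sum]
    rw [ih (fun s => ys s.castSucc) fun s => us s.castSucc]

/-- If every block `P^i Λ^i` equals `P`, then `P U_t = P K_t Z_t` for the joint action of the
decentralized strategies. -/
theorem mulVec_joint_localKS {r : Type*} {P : Matrix r (Σ i, Fin (du i)) ℝ}
    (hP : ∀ i, colBlock P i * sys.Lam i = P) (K : ℕ → Matrix (Σ i, Fin (du i)) (Fin dx) ℝ) (t : ℕ)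
    (ys : Fin (t + 1) → Vec dy) (us : Fin t → Vec du) :
    P *ᵥ joint (sys.localKS K) t ys us = P *ᵥ sys.centralKZ K t ys us := by
  rw [mulVec_eq_sum_colBlock, centralKZ, ← sum_S_eq_Z, mulVec_mulVec, Matrix.mulVec_sum]
  refine Finset.sum_congr rfl fun i _ => ?_
  have hblock : block i (joint (sys.localKS K) t ys us) = (sys.Lam i * K t) *ᵥ
      sys.S i t (fun s => block i (ys s)) (fun s => block i (us s)) := rfl
  rw [hblock, mulVec_mulVec, ← Matrix.mul_assoc, hP]

/-- The decentralized strategies and `U_t = K_t Z_t` produce the same states and estimates: their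
actions may differ, but have the same image under `B`. -/
theorem Substitutable.state_estimate_joint_localKS (hsub : sys.Substitutable)
    (K : ℕ → Matrix (Σ i, Fin (du i)) (Fin dx) ℝ) (x₁ : St dx) (w : ℕ → St dx) (v : ℕ → Vec dy)
    (t : ℕ) :
    sys.state (joint (sys.localKS K)) x₁ w v t = sys.state (sys.centralKZ K) x₁ w v t ∧
      sys.estimate (joint (sys.localKS K)) x₁ w v t =
        sys.estimate (sys.centralKZ K) x₁ w v t := by
  induction t with
  | zero => exact ⟨rfl, rfl⟩
  | succ t ih =>
    have hact : sys.B *ᵥ sys.action (joint (sys.localKS K)) x₁ w v t =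
        sys.B *ᵥ sys.action (sys.centralKZ K) x₁ w v t := by
      rw [action, mulVec_joint_localKS hsub.colBlock_B_mul_Lam]
      exact congrArg (fun z => sys.B *ᵥ K t *ᵥ z) ih.2
    have hstate : sys.state (joint (sys.localKS K)) x₁ w v (t + 1) =
        sys.state (sys.centralKZ K) x₁ w v (t + 1) := by
      rw [state_succ, state_succ, hact, ih.1]
    exact ⟨hstate, by rw [estimate_succ_eq, estimate_succ_eq, hact, hstate, ih.2]⟩

theorem Substitutable.expCost_joint_localKS (hsub : sys.Substitutable)
    (K : ℕ → Matrix (Σ i, Fin (du i)) (Fin dx) ℝ) (T : ℕ) {Ω : Type*} [MeasurableSpace Ω]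
    (μ : Measure Ω) (X₁ : Ω → St dx) (W : ℕ → Ω → St dx) (V : ℕ → Ω → Vec dy) :
    sys.expCost T μ X₁ W V (joint (sys.localKS K)) =
      sys.expCost T μ X₁ W V (sys.centralKZ K) := by
  refine lintegral_congr fun ω => congrArg _ (Finset.sum_congr rfl fun t _ => ?_)
  obtain ⟨hX, hZ⟩ := hsub.state_estimate_joint_localKS K (X₁ ω) (fun s => W s ω) (fun s => V s ω) t
  have hact : sys.N *ᵥ sys.action (joint (sys.localKS K)) (X₁ ω) (fun s => W s ω)
        (fun s => V s ω) t =
      sys.N *ᵥ sys.action (sys.centralKZ K) (X₁ ω) (fun s => W s ω) (fun s => V s ω) t := by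
    rw [action, mulVec_joint_localKS hsub.colBlock_N_mul_Lam]
    exact congrArg (fun z => sys.N *ᵥ K t *ᵥ z) hZ
  rw [stageCost, stageCost, hX, hact]

theorem measurable_S (i : Fin n) (t : ℕ) :
    Measurable fun p : (Fin (t + 1) → Fin (dy i) → ℝ) × (Fin t → Fin (du i) → ℝ) =>
      sys.S i t p.1 p.2 := by
  induction t with
  | zero => exact ((measurable_pi_apply 0).comp measurable_fst).mulVec _
  | succ t ih =>
    have hpast : Measurable
        fun p : (Fin (t + 2) → Fin (dy i) → ℝ) × (Fin (t + 1) → Fin (du i) → ℝ) =>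
        ((fun s : Fin (t + 1) => p.1 s.castSucc, fun s : Fin t => p.2 s.castSucc) :
          (Fin (t + 1) → Fin (dy i) → ℝ) × (Fin t → Fin (du i) → ℝ)) := by fun_prop
    exact ((((ih.comp hpast).mulVec _).add
      (((measurable_pi_apply _).comp measurable_snd).mulVec _)).mulVec _).add
      (((measurable_pi_apply _).comp measurable_fst).mulVec _)

theorem localAdmissible_localKS (K : ℕ → Matrix (Σ i, Fin (du i)) (Fin dx) ℝ) :
    LocalAdmissible (sys.localKS K) :=
  fun i t => (measurable_S i t).mulVec _

theorem LocalAdmissible.joint {g : LocalStrategy du dy} (hg : LocalAdmissible g) :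
    CentralAdmissible (joint g) := by
  refine fun t => measurable_pi_iff.2 fun q => ?_
  have hblock : Measurable fun p : (Fin (t + 1) → Vec dy) × (Fin t → Vec du) =>
      ((fun s => block q.1 (p.1 s), fun s => block q.1 (p.2 s)) :
        (Fin (t + 1) → Fin (dy q.1) → ℝ) × (Fin t → Fin (du q.1) → ℝ)) := by
    unfold block
    fun_prop
  exact (measurable_pi_apply q.2).comp ((hg q.1 t).comp hblock)

end LQGSystem

end

theorem theorem2 {n dx dc : ℕ} {du dy : Fin n → ℕ} (sys : LQGSystem n dx dc du dy)
    (hsub : sys.Substitutable) (T : ℕ) (hinn : ∀ t < T, IsUnit (sys.innovCov t))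
    {Ω : Type*} [MeasurableSpace Ω] (μ : Measure Ω) [IsProbabilityMeasure μ]
    (X₁ : Ω → LQGSystem.St dx) (W : ℕ → Ω → LQGSystem.St dx) (V : ℕ → Ω → LQGSystem.Vec dy)
    (hmodel : sys.IsGaussianModel T μ X₁ W V) :
    (∃ K : ℕ → Matrix (Σ i, Fin (du i)) (Fin dx) ℝ,
      sys.CentralOptimal T μ X₁ W V (sys.centralKZ K)) ∧
    ∀ K : ℕ → Matrix (Σ i, Fin (du i)) (Fin dx) ℝ,
      sys.CentralOptimal T μ X₁ W V (sys.centralKZ K) →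
      (∀ t < T,
        (fun ω =>
          sys.Z t (sys.info (sys.centralKZ K) (X₁ ω) (fun s => W s ω) (fun s => V s ω) t).1
            (sys.info (sys.centralKZ K) (X₁ ω) (fun s => W s ω) (fun s => V s ω) t).2)
        =ᵐ[μ]
        μ[fun ω => sys.state (sys.centralKZ K) (X₁ ω) (fun s => W s ω) (fun s => V s ω) t |
          MeasurableSpace.comap
            (fun ω => sys.info (sys.centralKZ K) (X₁ ω) (fun s => W s ω) (fun s => V s ω) t)
            inferInstance]) ∧
      sys.LocalOptimal T μ X₁ W V (sys.localKS K) ∧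
      sys.expCost T μ X₁ W V (LQGSystem.joint (sys.localKS K)) =
        sys.expCost T μ X₁ W V (sys.centralKZ K) ∧
      sys.expCost T μ X₁ W V (sys.centralKZ K) ≠ ∞ := by
  obtain ⟨K₀, hopt₀, hfin₀⟩ := hmodel.exists_centralOptimal hinn
  refine ⟨⟨K₀, hopt₀⟩, fun K hopt => ?_⟩
  have hcost := hsub.expCost_joint_localKS K T μ X₁ W V
  refine ⟨fun t ht => hmodel.estimate_ae_eq_condExp hinn K ht,
    ⟨LQGSystem.localAdmissible_localKS K, fun g' hg' => ?_⟩, hcost,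
    ne_top_of_le_ne_top hfin₀ (hopt.2 _ hopt₀.1)⟩
  rw [hcost]
  exact hopt.2 _ hg'.joint
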